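/- Let $\mathfrak g$ be a real nilpotent Lie algebra of dimension $8$, with ascending central series $\mathfrak g_0=0$, $\mathfrak g_k=\{X\in\mathfrak g : [X,\mathfrak g]\subseteq\mathfrak g_{k-1}\}$. We say that $\mathfrak g$ has ascending type $(m_1,\dots,m_s)$ if $s$ is its nilpotency step and $m_k=\dim\mathfrak g_k$ for $1\le k\le s$. Let $J$ be a complex structure on $\mathfrak g$, i.e. $J\in\mathrm{End}(\mathfrak g)$ with $J^2=-\mathrm{Id}$ and $[X,Y]+J[JX,Y]+J[X,JY]-[JX,JY]=0$ for all $X,Y$, and suppose that $J$ is strongly non-nilpotent (SnN), i.e. $\{X\in\mathfrak g : [X,\mathfrak g]=0=[JX,\mathfrak g]\}=0$. Then $\dim\mathfrak g_1=1$, $\dim\mathfrak g_2\in\{3,4,5\}$, and there is a basis $\omega^1,\dots,\omega^4$ of the complex space of $(1,0)$-forms of $(\mathfrak g,J)$ which satisfies the following equations. Here $d\alpha(X,Y)=-\alpha([X,Y])$, $\omega^{jk}=\omega^j\wedge\omega^k$, $\omega^{j\bar k}=\omega^j\wedge\overline{\omega^k}$, capital letters are complex numbers, and $s,t$ are real numbers;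 the coefficients automatically satisfy the relations imposed by the Jacobi identity of $\mathfrak g$. (1) If $\dim\mathfrak g_2=3$, then $\mathfrak g$ has ascending type $(1,3,8)$, $(1,3,6,8)$, $(1,3,5,8)$ or $(1,3,5,6,8)$, and $$\begin{aligned} d\omega^1&=0,\\ d\omega^2&=A\,\omega^{1\bar1}-B(\omega^{14}-\omega^{1\bar4}),\\ d\omega^3&=(C-D)\,\omega^{12}-E(\omega^{14}-\omega^{1\bar4})+F\,\omega^{1\bar1}+(G+D)\,\omega^{1\bar2}-H(\omega^{24}-\omega^{2\bar4})+(C-G)\,\omega^{2\bar1}+K\,\omega^{2\bar2},\\ d\omega^4&=L\,\omega^{1\bar1}+M\,\omega^{1\bar2}+N\,\omega^{1\bar3}-\bar M\,\omega^{2\bar1}+i\,s\,\omega^{2\bar2}+P\,\omega^{2\bar3}-\bar N\,\omega^{3\bar1}-\bar P\,\omega^{3\bar2}, \end{aligned}$$ where: for type $(1,3,8)$, $A=B=0$ and $\operatorname{Re}L=0$; for type $(1,3,6,8)$, $B=H=K=P=0$; for type $(1,3,5,8)$, $K=P=0$ and $\operatorname{Re}L=0$; for type $(1,3,5,6,8)$,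 $H=K=P=s=0$ and $\operatorname{Re}L\ne0$. (2) If $\dim\mathfrak g_2=4$, then $\mathfrak g$ has ascending type $(1,4,8)$ or $(1,4,6,8)$, and $$\begin{aligned} d\omega^1&=0,\qquad d\omega^2=A\,\omega^{1\bar1},\\ d\omega^3&=-D(\omega^{12}-\omega^{1\bar2})-E(\omega^{14}-\omega^{1\bar4})+F\,\omega^{1\bar1},\\ d\omega^4&=L\,\omega^{1\bar1}+M\,\omega^{1\bar2}+N\,\omega^{1\bar3}-\bar M\,\omega^{2\bar1}+i\,s\,\omega^{2\bar2}-\bar N\,\omega^{3\bar1}, \end{aligned}$$ where: for type $(1,4,8)$, $(\operatorname{Re}A,\operatorname{Re}L)=(0,0)$; for type $(1,4,6,8)$, $(\operatorname{Re}A,\operatorname{Re}L)\ne(0,0)$. (3) If $\dim\mathfrak g_2=5$, then $\mathfrak g$ has ascending type $(1,5,8)$ or $(1,5,6,8)$, and $$\begin{aligned} d\omega^1&=0,\qquad d\omega^2=A\,\omega^{1\bar1}-B(\omega^{14}-\omega^{1\bar4}),\qquad d\omega^3=F\,\omega^{1\bar1}-E(\omega^{14}-\omega^{1\bar4}),\\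 d\omega^4&=L\,\omega^{1\bar1}+M\,\omega^{1\bar2}+N\,\omega^{1\bar3}-\bar M\,\omega^{2\bar1}+i\,s\,\omega^{2\bar2}+P\,\omega^{2\bar3}-\bar N\,\omega^{3\bar1}-\bar P\,\omega^{3\bar2}+i\,t\,\omega^{3\bar3}, \end{aligned}$$ where: for type $(1,5,8)$, $\operatorname{Re}L=0$; for type $(1,5,6,8)$, $\operatorname{Re}L\ne0$. -/

import Mathlib

noncomputable section

namespace NilComplex

variable {g : Type*} [LieRing g] [LieAlgebra ℝ g]

/-- A complex structure on the real Lie algebra `g`: an endomorphism `J` with `J² = -Id` and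
vanishing Nijenhuis tensor. -/
structure IsComplexStructure (J : g →ₗ[ℝ] g) : Prop where
  sq : ∀ X, J (J X) = -X
  nijenhuis : ∀ X Y, ⁅X, Y⁆ + J ⁅J X, Y⁆ + J ⁅X, J Y⁆ - ⁅J X, J Y⁆ = 0

variable (g) in
/-- The `k`-th term `g_k` of the ascending central series: `g_0 = 0` and
`g_{k+1} = {X | [X, g] ⊆ g_k}`. -/
abbrev ascending (k : ℕ) : LieSubmodule ℝ g g := (⊥ : LieSubmodule ℝ g g).ucs k

variable (g) in
/-- `g` has ascending type `(m_1, …, m_s)`: `s` is the nilpotency step of `g`, and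
`dim g_k = m_k` for `1 ≤ k ≤ s`. The list is indexed from `0`, so `m_k` is entry `k - 1`. -/
def HasAscendingType (m : List ℕ) : Prop :=
  IsLeast {s : ℕ | 1 ≤ s ∧ ∀ k, s ≤ k → ascending g k = ⊤} m.length ∧
  ∀ (k : ℕ) (hk : k < m.length), Module.finrank ℝ (ascending g (k + 1)) = m[k]

/-- The ascending `J`-compatible series: `a_0(J) = 0` and
`a_{k+1}(J) = {X | [X, g] ⊆ a_k(J) and [J X, g] ⊆ a_k(J)}`. -/
def compatibleSeries (J : g →ₗ[ℝ] g) : ℕ → Submodule ℝ g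
  | 0 => ⊥
  | k + 1 =>
    { carrier := {X | ∀ Y, ⁅X, Y⁆ ∈ compatibleSeries J k ∧ ⁅J X, Y⁆ ∈ compatibleSeries J k}
      add_mem' := by
        intro X X' hX hX' Y
        rw [map_add, add_lie, add_lie]
        exact ⟨add_mem (hX Y).1 (hX' Y).1, add_mem (hX Y).2 (hX' Y).2⟩
      zero_mem' := by
        intro Y
        simp
      smul_mem' := by
        intro c X hX Y
        rw [map_smul, smul_lie, smul_lie]
        exact ⟨Submodule.smul_mem _ c (hX Y).1, Submodule.smul_mem _ c (hX Y).2⟩ }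

/-- `J` is strongly non-nilpotent (SnN): `a_1(J) = 0`. -/
def IsSnN (J : g →ₗ[ℝ] g) : Prop := compatibleSeries J 1 = ⊥

/-- The complex vector space of `(1,0)`-forms of `(g, J)`, inside the space of complex-valued
real-linear forms on `g` (the complexified dual). -/
def formsOneZero (J : g →ₗ[ℝ] g) : Submodule ℂ (g →ₗ[ℝ] ℂ) where
  carrier := {α | ∀ X, α (J X) = Complex.I * α X}
  add_mem' := by
    intro α β hα hβ X
    rw [LinearMap.add_apply, LinearMap.add_apply, hα X, hβ X, mul_add]
  zero_mem' := by
    intro X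
    simp
  smul_mem' := by
    intro c α hα X
    rw [LinearMap.smul_apply, LinearMap.smul_apply, hα X, smul_eq_mul, smul_eq_mul]
    ring

/-- Complex-valued real-bilinear forms on `g`; all those below are alternating. -/
abbrev TwoForm (g : Type*) [LieRing g] [LieAlgebra ℝ g] := g →ₗ[ℝ] g →ₗ[ℝ] ℂ

/-- The differential of a one-form: `dα (X, Y) = -α [X, Y]`. -/
def dOne (α : g →ₗ[ℝ] ℂ) : TwoForm g :=
  LinearMap.mk₂ ℝ (fun X Y => -α ⁅X, Y⁆)
    (by intro X X' Y; rw [add_lie, map_add, neg_add])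
    (by intro c X Y; rw [smul_lie, map_smul, smul_neg])
    (by intro X Y Y'; rw [lie_add, map_add, neg_add])
    (by intro c X Y; rw [lie_smul, map_smul, smul_neg])

/-- The wedge product of one-forms: `(α ∧ β) (X, Y) = α X * β Y - α Y * β X`. -/
def wedge (α β : g →ₗ[ℝ] ℂ) : TwoForm g :=
  LinearMap.mk₂ ℝ (fun X Y => α X * β Y - α Y * β X)
    (by intro X X' Y; simp only [map_add]; ring)
    (by intro c X Y; simp only [map_smul, Complex.real_smul]; ring)
    (by intro X Y Y'; simp only [map_add]; ring)
    (by intro c X Y; simp only [map_smul, Complex.real_smul]; ring)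

/-- The complex conjugate of a one-form. -/
def conjForm (α : g →ₗ[ℝ] ℂ) : g →ₗ[ℝ] ℂ := Complex.conjAe.toLinearMap ∘ₗ α

/-- `cc z` is the complex conjugate of `z`. -/
abbrev cc (z : ℂ) : ℂ := (starRingEnd ℂ) z

/-- Complex structure equations for `dim g_2 = 3`. In these three definitions `w ωⱼ ωₖ` is
`ω^{jk} = ω^j ∧ ω^k` and `v ωⱼ ωₖ` is `ω^{j \bar k} = ω^j ∧ \overline{ω^k}`. -/
def StructureEquationsThree (ω₁ ω₂ ω₃ ω₄ : g →ₗ[ℝ] ℂ)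
    (A B C D E F G H K L M N P : ℂ) (s : ℝ) : Prop :=
  let w := fun α β : g →ₗ[ℝ] ℂ => wedge α β
  let v := fun α β : g →ₗ[ℝ] ℂ => wedge α (conjForm β)
  dOne ω₁ = 0 ∧
  dOne ω₂ = A • v ω₁ ω₁ - B • (w ω₁ ω₄ - v ω₁ ω₄) ∧
  dOne ω₃ = (C - D) • w ω₁ ω₂ - E • (w ω₁ ω₄ - v ω₁ ω₄) + F • v ω₁ ω₁ + (G + D) • v ω₁ ω₂
    - H • (w ω₂ ω₄ - v ω₂ ω₄) + (C - G) • v ω₂ ω₁ + K • v ω₂ ω₂ ∧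
  dOne ω₄ = L • v ω₁ ω₁ + M • v ω₁ ω₂ + N • v ω₁ ω₃ - cc M • v ω₂ ω₁
    + (Complex.I * (s : ℂ)) • v ω₂ ω₂ + P • v ω₂ ω₃ - cc N • v ω₃ ω₁ - cc P • v ω₃ ω₂

/-- Complex structure equations for `dim g_2 = 4`. -/
def StructureEquationsFour (ω₁ ω₂ ω₃ ω₄ : g →ₗ[ℝ] ℂ)
    (A D E F L M N : ℂ) (s : ℝ) : Prop :=
  let w := fun α β : g →ₗ[ℝ] ℂ => wedge α β
  let v := fun α β : g →ₗ[ℝ] ℂ => wedge α (conjForm β)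
  dOne ω₁ = 0 ∧
  dOne ω₂ = A • v ω₁ ω₁ ∧
  dOne ω₃ = -(D • (w ω₁ ω₂ - v ω₁ ω₂)) - E • (w ω₁ ω₄ - v ω₁ ω₄) + F • v ω₁ ω₁ ∧
  dOne ω₄ = L • v ω₁ ω₁ + M • v ω₁ ω₂ + N • v ω₁ ω₃ - cc M • v ω₂ ω₁
    + (Complex.I * (s : ℂ)) • v ω₂ ω₂ - cc N • v ω₃ ω₁

/-- Complex structure equations for `dim g_2 = 5`. -/
def StructureEquationsFive (ω₁ ω₂ ω₃ ω₄ : g →ₗ[ℝ] ℂ)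
    (A B E F L M N P : ℂ) (s t : ℝ) : Prop :=
  let w := fun α β : g →ₗ[ℝ] ℂ => wedge α β
  let v := fun α β : g →ₗ[ℝ] ℂ => wedge α (conjForm β)
  dOne ω₁ = 0 ∧
  dOne ω₂ = A • v ω₁ ω₁ - B • (w ω₁ ω₄ - v ω₁ ω₄) ∧
  dOne ω₃ = F • v ω₁ ω₁ - E • (w ω₁ ω₄ - v ω₁ ω₄) ∧
  dOne ω₄ = L • v ω₁ ω₁ + M • v ω₁ ω₂ + N • v ω₁ ω₃ - cc M • v ω₂ ω₁
    + (Complex.I * (s : ℂ)) • v ω₂ ω₂ + P • v ω₂ ω₃ - cc N • v ω₃ ω₁ - cc P • v ω₃ ω₂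
    + (Complex.I * (t : ℂ)) • v ω₃ ω₃

end NilComplex

end

/-! View g as a complex 4-space E with J as multiplication by i. Then [x,y] = μ(x,y) + ρ(x,y) −
ρ(y,x), where μ is complex bilinear and alternating, and ρ is conjugate-linear in its first
argument. The Jacobi identity separates by type into three statements: μ is a Lie bracket, ρ is a
conjugate-linear representation of (E, μ) on E, and one compatibility identity, `mix`, links the
two. Nilpotency of g makes every μ(x) nilpotent and makes all ρ(x) lower one common filtration, so
that words in the ρ(x) are nilpotent too. SnN says that no nonzero x is annihilated by μ(x,·),
ρ(x,·) and ρ(·,x) together.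

Take a nonzero central z and put ζ = Jz. Then ρ(·,ζ) = 0 and ρ(ζ,·) = μ(ζ,·) =: N, a nilpotent
derivation of μ, nonzero by SnN, whose range does not contain ζ. In dimension 4 this leaves two
cases: N² ≠ 0, where E is spanned by Y, NY, N²Y, ζ, or N of rank one. The second splits according to
whether μ(Y, NY) leaves the span of NY and ζ. In every case the derivation N restricts μ,
commutators with N restrict ρ, vanishing eigenvalues make ρ triangular, and `mix` with SnN settles
the remaining coefficients. The outcome is `MatchedBracket.exists_normalForm`: one shape of
structure constants with five alternatives.

Multiplying the last coordinate by i makes f₃(z) = 1, and the bracket then sees f₃ only through Im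
f₃. Each term of the ascending series is cut out by real equations in the coordinates, and dim g₂ is
3, 3, 3, 4, 5 in the five alternatives. The later terms are governed by Im f₃[x,y] = 2 Re L ·
Im(conj(f₀x) f₀y) and, when B = 0, also by A. The forms obtained are more special than required: K,
P and t always vanish. -/

namespace NilComplex

open Module

/-! ### Nilpotent operators: vanishing eigenvalues, trace and determinant on quotients -/

section Nilpotent

variable {E : Type*} [AddCommGroup E] [Module ℂ E]

/-- A linear map lowering a decreasing filtration from `⊤` to `⊥`. -/
def Lowers (Fil : ℕ → Submodule ℂ E) (A : E →ₗ[ℂ] E) : Prop :=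
  ∀ k, ∀ x ∈ Fil k, A x ∈ Fil (k + 1)

lemma Lowers.comp {Fil : ℕ → Submodule ℂ E} (hF : Antitone Fil) {A B : E →ₗ[ℂ] E}
    (hA : Lowers Fil A) (hB : Lowers Fil B) : Lowers Fil (A ∘ₗ B) := fun k x hx =>
  hF (Nat.le_succ (k + 1)) (hA (k + 1) _ (hB k x hx))

lemma Lowers.isNilpotent {Fil : ℕ → Submodule ℂ E} (h0 : Fil 0 = ⊤) (h1 : ∃ n, Fil n = ⊥)
    {A : E →ₗ[ℂ] E} (hA : Lowers Fil A) : IsNilpotent A := by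
  obtain ⟨n, hn⟩ := h1
  have h : ∀ k x, (A ^ k) x ∈ Fil k := by
    intro k
    induction k with
    | zero => intro x; rw [h0]; trivial
    | succ k ih => intro x; rw [pow_succ']; exact hA k _ (ih x)
  refine ⟨n, LinearMap.ext fun x => ?_⟩
  have := h n x
  rw [hn] at this
  simpa using this

/-- The scalar c is an eigenvalue of the nilpotent operator induced on E/K, with the class of v as
eigenvector. -/
lemma eigenvalue_zero {A : E →ₗ[ℂ] E} (hA : IsNilpotent A) (K : Submodule ℂ E)
    (hK : ∀ x ∈ K, A x ∈ K) {v : E} (hv : v ∉ K) {c : ℂ} (h : A v - c • v ∈ K) : c = 0 := by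
  obtain ⟨n, hn⟩ := hA
  have key : ∀ k : ℕ, (A ^ k) v - c ^ k • v ∈ K := by
    intro k
    induction k with
    | zero => simp
    | succ k ih =>
      have h1 := hK _ ih
      have h2 := K.smul_mem (c ^ k) h
      have : (A ^ (k + 1)) v - c ^ (k + 1) • v
          = A ((A ^ k) v - c ^ k • v) + c ^ k • (A v - c • v) := by
        rw [pow_succ' A, Module.End.mul_apply, map_sub, map_smul]
        module
      rw [this]
      exact K.add_mem h1 h2
  have h1 := key n
  rw [hn, LinearMap.zero_apply, zero_sub, K.neg_mem_iff] at h1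
  by_contra hc
  exact hv ((K.smul_mem_iff (pow_ne_zero n hc)).1 h1)

/-- The classes of v and w span an invariant plane in E/K, and the rows of the 2×2 matrix are the
images of v and w there. Independence modulo K makes that matrix nilpotent. -/
lemma trace_det_zero {A : E →ₗ[ℂ] E} (hA : IsNilpotent A) (K : Submodule ℂ E)
    (hK : ∀ x ∈ K, A x ∈ K) {v w : E} (hvw : ∀ x y : ℂ, x • v + y • w ∈ K → x = 0 ∧ y = 0)
    {a b c d : ℂ} (hv : A v - (a • v + b • w) ∈ K) (hw : A w - (c • v + d • w) ∈ K) :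
    a + d = 0 ∧ a * d - b * c = 0 := by
  obtain ⟨n, hn⟩ := hA
  let M : Matrix (Fin 2) (Fin 2) ℂ := !![a, b; c, d]
  have key : ∀ k : ℕ, (A ^ k) v - ((M ^ k) 0 0 • v + (M ^ k) 0 1 • w) ∈ K ∧
      (A ^ k) w - ((M ^ k) 1 0 • v + (M ^ k) 1 1 • w) ∈ K := by
    intro k
    induction k with
    | zero => simp
    | succ k ih =>
      have e : ∀ i j, (M ^ (k + 1)) i j = (M ^ k) i 0 * M 0 j + (M ^ k) i 1 * M 1 j := by
        intro i j
        rw [pow_succ, Matrix.mul_apply, Fin.sum_univ_two]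
      have m00 : M 0 0 = a := rfl
      have m01 : M 0 1 = b := rfl
      have m10 : M 1 0 = c := rfl
      have m11 : M 1 1 = d := rfl
      simp only [e, m00, m01, m10, m11, pow_succ' A, Module.End.mul_apply]
      generalize (M ^ k) 0 0 = p at *
      generalize (M ^ k) 0 1 = q at *
      generalize (M ^ k) 1 0 = r at *
      generalize (M ^ k) 1 1 = s at *
      constructor
      · have := K.add_mem (hK _ ih.1) (K.add_mem (K.smul_mem p hv) (K.smul_mem q hw))
        convert this using 1
        simp only [map_sub, map_add, map_smul]
        module
      · have := K.add_mem (hK _ ih.2) (K.add_mem (K.smul_mem r hv) (K.smul_mem s hw))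
        convert this using 1
        simp only [map_sub, map_add, map_smul]
        module
  have hM : M ^ n = 0 := by
    have h1 := key n
    rw [hn] at h1
    simp only [LinearMap.zero_apply, zero_sub, K.neg_mem_iff] at h1
    have h2 := hvw _ _ h1.1
    have h3 := hvw _ _ h1.2
    ext i j
    fin_cases i <;> fin_cases j <;> simp [h2, h3]
  have hnil : IsNilpotent M := ⟨n, hM⟩
  constructor
  · have := (Matrix.isNilpotent_trace_of_isNilpotent hnil).eq_zero
    simpa [M, Matrix.trace_fin_two] using this
  · have : M.det ^ n = 0 ∨ n = 0 := by
      rcases Nat.eq_zero_or_pos n with h | h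
      · exact Or.inr h
      · left
        rw [← Matrix.det_pow, hM, Matrix.det_zero]
    rcases this with h | h
    · have := eq_zero_of_pow_eq_zero h
      simpa [M, Matrix.det_fin_two] using this
    · subst h
      have := congrFun (congrFun hM 0) 0
      simp at this

end Nilpotent

/-! ### The complex data (μ, ρ) and bases of a 4-space -/

/-- The algebraic data carried by a Lie algebra with complex structure: `μ` is the bracket of
`(1,0)`-vectors, and `ρ x y` is the `(1,0)`-part of the bracket of the conjugate of `x` with `y`. -/
structure MatchedBracket {E : Type*} [AddCommGroup E] [Module ℂ E]
    (μ : E →ₗ[ℂ] E →ₗ[ℂ] E) (ρ : E →ₛₗ[starRingEnd ℂ] E →ₗ[ℂ] E) : Prop where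
  alt : ∀ x, μ x x = 0
  jac : ∀ x y v, μ x (μ y v) = μ (μ x y) v + μ y (μ x v)
  rep : ∀ x y v, ρ (μ x y) v = ρ x (ρ y v) - ρ y (ρ x v)
  mix : ∀ x x' y, ρ y (μ x x') = μ (ρ y x) x' + μ x (ρ y x') - ρ (ρ x y) x' + ρ (ρ x' y) x
  nilμ : ∀ x, IsNilpotent (μ x)
  nilρ : ∃ Fil : ℕ → Submodule ℂ E, Antitone Fil ∧ Fil 0 = ⊤ ∧ (∃ n, Fil n = ⊥) ∧
    ∀ x, Lowers Fil (ρ x)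
  snn : ∀ x, μ x = 0 → ρ x = 0 → (∀ y, ρ y x = 0) → x = 0

namespace MatchedBracket

variable {E : Type*} [AddCommGroup E] [Module ℂ E]
    {μ : E →ₗ[ℂ] E →ₗ[ℂ] E} {ρ : E →ₛₗ[starRingEnd ℂ] E →ₗ[ℂ] E}

lemma skew (h : MatchedBracket μ ρ) (x y : E) : μ x y = -μ y x := by
  have := h.alt (x + y)
  simp only [map_add, LinearMap.add_apply, h.alt, zero_add, add_zero] at this
  exact eq_neg_of_add_eq_zero_left (by rw [add_comm]; exact this)

lemma nil_one (h : MatchedBracket μ ρ) (x : E) : IsNilpotent (ρ x) := by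
  obtain ⟨Fil, -, h0, h1, h2⟩ := h.nilρ
  exact (h2 x).isNilpotent h0 h1

/-- Separate nilpotency of the factors would not suffice; the filtration common to all ρ x is what
gives nilpotent products. -/
lemma nil_two (h : MatchedBracket μ ρ) (x y : E) : IsNilpotent (ρ x ∘ₗ ρ y) := by
  obtain ⟨Fil, ha, h0, h1, h2⟩ := h.nilρ
  exact ((h2 x).comp ha (h2 y)).isNilpotent h0 h1

lemma nil_three (h : MatchedBracket μ ρ) (x y w : E) : IsNilpotent (ρ x ∘ₗ ρ y ∘ₗ ρ w) := by
  obtain ⟨Fil, ha, h0, h1, h2⟩ := h.nilρ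
  exact ((h2 x).comp ha ((h2 y).comp ha (h2 w))).isNilpotent h0 h1

end MatchedBracket

lemma exists_basis_four {E : Type*} [AddCommGroup E] [Module ℂ E] (hE : finrank ℂ E = 4)
    (u₀ u₁ u₂ u₃ : E) (h : ∀ a b c d : ℂ, a • u₀ + b • u₁ + c • u₂ + d • u₃ = 0 →
      a = 0 ∧ b = 0 ∧ c = 0 ∧ d = 0) :
    ∃ b : Basis (Fin 4) ℂ E, b 0 = u₀ ∧ b 1 = u₁ ∧ b 2 = u₂ ∧ b 3 = u₃ := by
  have hli : LinearIndependent ℂ ![u₀, u₁, u₂, u₃] := by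
    rw [Fintype.linearIndependent_iff]
    intro f hf
    rw [Fin.sum_univ_four] at hf
    obtain ⟨h0, h1, h2, h3⟩ := h _ _ _ _ hf
    intro i
    fin_cases i <;> assumption
  refine ⟨basisOfLinearIndependentOfCardEqFinrank hli (by simp [hE]), ?_, ?_, ?_, ?_⟩ <;> simp

lemma basis_four_indep {E : Type*} [AddCommGroup E] [Module ℂ E] (b : Basis (Fin 4) ℂ E)
    {a₀ a₁ a₂ a₃ : ℂ} (h : a₀ • b 0 + a₁ • b 1 + a₂ • b 2 + a₃ • b 3 = 0) :
    a₀ = 0 ∧ a₁ = 0 ∧ a₂ = 0 ∧ a₃ = 0 := by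
  have := Fintype.linearIndependent_iff.1 b.linearIndependent ![a₀, a₁, a₂, a₃]
    (by simpa [Fin.sum_univ_four] using h)
  exact ⟨this 0, this 1, this 2, this 3⟩

lemma basis_four_expand {E : Type*} [AddCommGroup E] [Module ℂ E] (b : Basis (Fin 4) ℂ E) (x : E) :
    ∃ a₀ a₁ a₂ a₃ : ℂ, x = a₀ • b 0 + a₁ • b 1 + a₂ • b 2 + a₃ • b 3 :=
  ⟨b.repr x 0, b.repr x 1, b.repr x 2, b.repr x 3, by
    have := (b.sum_repr x).symm
    rwa [Fin.sum_univ_four] at this⟩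

end NilComplex

namespace NilComplex

open Module

section Eigen

variable {E : Type*} [AddCommGroup E] [Module ℂ E] {A : E →ₗ[ℂ] E}

lemma eigenvalue_zero₀ (hA : IsNilpotent A) {v : E} (hv : v ≠ 0) {c : ℂ} (h : A v = c • v) :
    c = 0 :=
  eigenvalue_zero hA ⊥ (by simp) (v := v) (by simpa using hv) (by simp [h])

lemma eigenvalue_zero₁ (hA : IsNilpotent A) {u v : E} {e c d : ℂ} (hu : A u = e • u)
    (hv : ∀ t : ℂ, v ≠ t • u) (h : A v = c • v + d • u) : c = 0 := by
  refine eigenvalue_zero hA (Submodule.span ℂ {u}) ?_ (v := v) ?_ ?_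
  · intro x hx
    obtain ⟨t, rfl⟩ := Submodule.mem_span_singleton.1 hx
    rw [map_smul, hu]
    exact Submodule.mem_span_singleton.2 ⟨t * e, by module⟩
  · intro hx
    obtain ⟨t, ht⟩ := Submodule.mem_span_singleton.1 hx
    exact hv t ht.symm
  · exact Submodule.mem_span_singleton.2 ⟨d, by rw [h]; module⟩

lemma eigenvalue_zero₂ (hA : IsNilpotent A) {u w v : E} {e₁ e₂ f₁ f₂ c d₁ d₂ : ℂ}
    (hu : A u = e₁ • u + e₂ • w) (hw : A w = f₁ • u + f₂ • w)
    (hv : ∀ t s : ℂ, v ≠ t • u + s • w) (h : A v = c • v + d₁ • u + d₂ • w) : c = 0 := by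
  refine eigenvalue_zero hA (Submodule.span ℂ {u, w}) ?_ (v := v) ?_ ?_
  · intro x hx
    obtain ⟨t, s, rfl⟩ := Submodule.mem_span_pair.1 hx
    rw [map_add, map_smul, map_smul, hu, hw]
    exact Submodule.mem_span_pair.2 ⟨t * e₁ + s * f₁, t * e₂ + s * f₂, by module⟩
  · intro hx
    obtain ⟨t, s, ht⟩ := Submodule.mem_span_pair.1 hx
    exact hv t s ht.symm
  · exact Submodule.mem_span_pair.2 ⟨d₁, d₂, by rw [h]; module⟩

end Eigen

/-- The properties of `ζ = J z` for a nonzero central vector `z`. -/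
structure IsDistinguished {E : Type*} [AddCommGroup E] [Module ℂ E]
    (μ : E →ₗ[ℂ] E →ₗ[ℂ] E) (ρ : E →ₛₗ[starRingEnd ℂ] E →ₗ[ℂ] E) (ζ : E) : Prop where
  ne_zero : ζ ≠ 0
  right : ∀ x, ρ x ζ = 0
  left : ρ ζ = μ ζ

/-- The common shape of the structure constants, in a basis whose last vector is `ζ`. -/
structure NormalForm {E : Type*} [AddCommGroup E] [Module ℂ E]
    (μ : E →ₗ[ℂ] E →ₗ[ℂ] E) (ρ : E →ₛₗ[starRingEnd ℂ] E →ₗ[ℂ] E) (b : Basis (Fin 4) ℂ E)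
    (β ε η κ A F p q L m n : ℂ) (s : ℝ) : Prop where
  dist : IsDistinguished μ ρ (b 3)
  μ01 : μ (b 0) (b 1) = κ • b 2
  μ02 : μ (b 0) (b 2) = 0
  μ12 : μ (b 1) (b 2) = 0
  μ30 : μ (b 3) (b 0) = β • b 1 + ε • b 2
  μ31 : μ (b 3) (b 1) = η • b 2
  μ32 : μ (b 3) (b 2) = 0
  ρ00 : ρ (b 0) (b 0) = A • b 1 + F • b 2 + L • b 3
  ρ01 : ρ (b 0) (b 1) = p • b 2 + cc m • b 3
  ρ02 : ρ (b 0) (b 2) = cc n • b 3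
  ρ10 : ρ (b 1) (b 0) = q • b 2 + m • b 3
  ρ11 : ρ (b 1) (b 1) = (s : ℂ) • b 3
  ρ12 : ρ (b 1) (b 2) = 0
  ρ20 : ρ (b 2) (b 0) = n • b 3
  ρ21 : ρ (b 2) (b 1) = 0
  ρ22 : ρ (b 2) (b 2) = 0

/-! ### The regular case, where the square of μ ζ is nonzero -/

namespace MatchedBracket

variable {E : Type*} [AddCommGroup E] [Module ℂ E]
    {μ : E →ₗ[ℂ] E →ₗ[ℂ] E} {ρ : E →ₛₗ[starRingEnd ℂ] E →ₗ[ℂ] E} {ζ : E}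

/-- By skew-symmetry ζ is an eigenvector of the nilpotent operator μ w with eigenvalue −c. Hence ζ
never lies in the range of μ ζ. -/
lemma dist_not_range (h : MatchedBracket μ ρ) (hζ : IsDistinguished μ ρ ζ) {w : E} {c : ℂ}
    (hw : μ ζ w = c • ζ) : c = 0 := by
  have : μ w ζ = (-c) • ζ := by rw [h.skew, hw]; module
  simpa using eigenvalue_zero₀ (h.nilμ w) hζ.ne_zero this

lemma exists_last_power {A : E →ₗ[ℂ] E} (hA : IsNilpotent A) {j : ℕ} {v : E}
    (hv : (A ^ j) v ≠ 0) : ∃ k, (A ^ (j + k)) v ≠ 0 ∧ (A ^ (j + k + 1)) v = 0 := by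
  classical
  obtain ⟨n, hn⟩ := hA
  have hex : ∃ k, (A ^ (j + k)) v = 0 := ⟨n, by rw [pow_add, hn, mul_zero]; rfl⟩
  have h0 : Nat.find hex ≠ 0 := by
    intro h
    have := Nat.find_spec hex
    rw [h] at this
    exact hv this
  obtain ⟨k, hk⟩ := Nat.exists_eq_succ_of_ne_zero h0
  refine ⟨k, Nat.find_min hex (by omega), ?_⟩
  have := Nat.find_spec hex
  rwa [hk] at this

/-- With N = μ ζ, the vectors Y, NY, N²Y, ζ are independent because powers of N separate the chain
and ζ is outside the range of N. That N is a derivation then expresses the other brackets through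
μ(Y, NY), and nilpotency leaves only a multiple of N²Y there. -/
lemma exists_basis_regular (h : MatchedBracket μ ρ) (hE : finrank ℂ E = 4)
    (hζ : IsDistinguished μ ρ ζ) {Y : E} (hY : μ ζ (μ ζ Y) ≠ 0) :
    ∃ b : Basis (Fin 4) ℂ E, b 3 = ζ ∧ μ ζ (b 0) = b 1 ∧ μ ζ (b 1) = b 2 ∧ μ ζ (b 2) = 0 ∧
      μ (b 0) (b 1) = 0 ∧ μ (b 0) (b 2) = 0 ∧ μ (b 1) (b 2) = 0 := by
  -- The length of the chain of Y is not yet known; 2 + j is its last nonvanishing power.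
  obtain ⟨j, hj, hj'⟩ := exists_last_power (h.nilμ ζ) (j := 2) (v := Y) (by simpa [pow_two] using hY)
  have hNζ : μ ζ ζ = 0 := h.alt ζ
  have hpow : ∀ k, (μ ζ ^ (k + 1)) ζ = 0 := fun k => by
    rw [pow_succ, Module.End.mul_apply, hNζ, map_zero]
  have hshift : ∀ k x, (μ ζ ^ k) (μ ζ x) = (μ ζ ^ (k + 1)) x := fun k x => by
    rw [pow_succ, Module.End.mul_apply]
  have hbig : ∀ k, (μ ζ ^ (2 + j + 1 + k)) Y = 0 := fun k => by
    rw [add_comm _ k, pow_add, Module.End.mul_apply, hj', map_zero]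
  have hindep : ∀ a b c d : ℂ, a • Y + b • μ ζ Y + c • μ ζ (μ ζ Y) + d • ζ = 0 →
      a = 0 ∧ b = 0 ∧ c = 0 ∧ d = 0 := by
    intro a b c d e
    have ha : a = 0 := by
      have := congrArg (μ ζ ^ (2 + j)) e
      simp only [map_add, map_smul, hshift, map_zero] at this
      rw [show 2 + j + 1 + 1 = 2 + j + 1 + 1 from rfl, hj', hbig 1,
        show 2 + j = (1 + j) + 1 by omega, hpow, show 1 + j + 1 = 2 + j by omega] at this
      simpa [hj] using this
    subst ha
    have hb : b = 0 := by
      have := congrArg (μ ζ ^ (1 + j)) e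
      simp only [map_add, map_smul, hshift, map_zero] at this
      rw [show 1 + j + 1 + 1 = 2 + j + 1 by omega, hj', show 1 + j = j + 1 by omega, hpow,
        show j + 1 + 1 = 2 + j by omega] at this
      simpa [hj] using this
    subst hb
    have hd : d = 0 := by
      by_contra hd
      have : μ ζ (c • μ ζ Y) = (-d) • ζ := by
        rw [map_smul]; linear_combination (norm := module) e
      exact hd (by simpa using h.dist_not_range hζ this)
    subst hd
    have hc : c = 0 := by simpa [hY] using e
    exact ⟨rfl, rfl, hc, rfl⟩
  obtain ⟨b, hb0, hb1, hb2, hb3⟩ := exists_basis_four hE _ _ _ _ hindep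
  have hN3 : μ ζ (b 2) = 0 := by
    obtain ⟨x₀, x₁, x₂, x₃, hx⟩ := basis_four_expand b (μ ζ (b 2))
    rw [hb0, hb1, hb2, hb3] at hx
    have h0 : x₀ = 0 := by
      have := congrArg (μ ζ ^ (2 + j)) hx
      simp only [map_add, map_smul, hshift] at this
      rw [show 2 + j + 1 + 1 + 1 = 2 + j + 1 + 2 by omega, hbig 2, hj',
        show 2 + j + 1 + 1 = 2 + j + 1 + 1 from rfl, hbig 1,
        show 2 + j = (1 + j) + 1 by omega, hpow, show 1 + j + 1 = 2 + j by omega] at this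
      simpa [hj] using this.symm
    subst h0
    have h1 : x₁ = 0 := by
      have := congrArg (μ ζ ^ (1 + j)) hx
      simp only [map_add, map_smul, hshift] at this
      rw [show 1 + j + 1 + 1 + 1 = 2 + j + 1 + 1 by omega, hbig 1,
        show 1 + j + 1 + 1 = 2 + j + 1 by omega, hj', show 1 + j = j + 1 by omega, hpow,
        show j + 1 + 1 = 2 + j by omega] at this
      simpa [hj] using this.symm
    subst h1
    have h2 : x₂ = 0 := by
      refine eigenvalue_zero₁ (h.nilμ ζ) (u := ζ) (v := μ ζ (μ ζ Y)) (e := 0) (by simp [hNζ]) ?_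
        (by rw [hx]; module)
      intro t ht
      have := hindep 0 0 1 (-t) (by rw [ht]; module)
      simp at this
    subst h2
    have h3 : x₃ = 0 := h.dist_not_range hζ (w := μ ζ (μ ζ Y)) (by rw [hx]; module)
    rw [hb2, hx, h3]; module
  have hder : ∀ x y, μ ζ (μ x y) = μ (μ ζ x) y + μ x (μ ζ y) := fun x y => h.jac ζ x y
  have hN0 : μ ζ (b 0) = b 1 := by rw [hb0, hb1]
  have hN1 : μ ζ (b 1) = b 2 := by rw [hb1, hb2]
  obtain ⟨a₀, a₁, a₂, a₃, ha⟩ := basis_four_expand b (μ (b 0) (b 1))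
  have h02 : μ (b 0) (b 2) = a₀ • b 1 + a₁ • b 2 := by
    have := hder (b 0) (b 1)
    rw [ha, hN0, h.alt, hN1, zero_add] at this
    rw [← this]
    simp only [map_add, map_smul, hN0, hN1, hN3, hb3, hNζ]
    module
  have h12 : μ (b 1) (b 2) = a₀ • b 2 := by
    have := hder (b 0) (b 2)
    rw [h02, hN0, hN3, map_zero, add_zero] at this
    rw [← this]
    simp only [map_add, map_smul, hN1, hN3]
    module
  have ha0 : a₀ = 0 := eigenvalue_zero₀ (h.nilμ (b 1)) (b.ne_zero 2) h12
  subst ha0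
  have h02' : μ (b 0) (b 2) = a₁ • b 2 := by rw [h02]; module
  have ha1 : a₁ = 0 := eigenvalue_zero₀ (h.nilμ (b 0)) (b.ne_zero 2) h02'
  subst ha1
  have h02'' : μ (b 0) (b 2) = 0 := by rw [h02']; module
  have h12' : μ (b 1) (b 2) = 0 := by rw [h12]; module
  have h03 : μ (b 0) ζ = -b 1 := by rw [h.skew, hN0]
  -- The square of μ (b 0) sends ζ to −a₂ b₂ − a₃ ζ and kills b₂, so −a₃ is an eigenvalue modulo b₂.
  have ha3 : a₃ = 0 := by
    have hsq : IsNilpotent (μ (b 0) ^ 2) := (h.nilμ (b 0)).pow_of_pos (by norm_num)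
    have := eigenvalue_zero₁ hsq (u := b 2) (v := ζ) (e := 0) (c := -a₃) (d := -a₂)
      (by simp [pow_two, h02'']) ?_ ?_
    · simpa using this
    · intro t ht
      have := basis_four_indep b (a₀ := 0) (a₁ := 0) (a₂ := t) (a₃ := -1) (by rw [hb3, ht]; module)
      simp at this
    · rw [pow_two, Module.End.mul_apply, h03, map_neg, ha, hb3]; module
  subst ha3
  -- Since μ ζ b₁ = b₂, subtracting a₂ ζ from b₀ removes the remaining term a₂ b₂ of μ(b₀, b₁).
  obtain ⟨b', hb0', hb1', hb2', hb3'⟩ := exists_basis_four hE (b 0 - a₂ • b 3) (b 1) (b 2) (b 3)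
    (by
      intro x y z w e
      have := basis_four_indep b (a₀ := x) (a₁ := y) (a₂ := z) (a₃ := w - x * a₂)
        (by linear_combination (norm := module) e)
      obtain ⟨rfl, rfl, rfl, h3⟩ := this
      exact ⟨rfl, rfl, rfl, by simpa using h3⟩)
  refine ⟨b', by rw [hb3', hb3], ?_, ?_, ?_, ?_, ?_, ?_⟩
  · rw [hb0', hb1', map_sub, map_smul, hN0, hb3, hNζ]; module
  · rw [hb1', hb2', hN1]
  · rw [hb2', hN3]
  · rw [hb0', hb1', map_sub, map_smul, LinearMap.sub_apply, LinearMap.smul_apply, ha, hb3, hN1]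
    module
  · rw [hb0', hb2', map_sub, map_smul, LinearMap.sub_apply, LinearMap.smul_apply, h02'', hb3, hN3]
    module
  · rw [hb1', hb2', h12']

end MatchedBracket

end NilComplex

namespace NilComplex

open Module

lemma eigenvalue_zero_coord {E : Type*} [AddCommGroup E] [Module ℂ E] {A : E →ₗ[ℂ] E}
    (hA : IsNilpotent A) (b : Basis (Fin 4) ℂ E) {x₀ x₁ x₂ x₃ y₁ y₂ y₃ z₁ z₂ z₃ w₁ w₂ w₃ : ℂ}
    (h0 : A (b 0) = x₀ • b 0 + x₁ • b 1 + x₂ • b 2 + x₃ • b 3)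
    (h1 : A (b 1) = y₁ • b 1 + y₂ • b 2 + y₃ • b 3)
    (h2 : A (b 2) = z₁ • b 1 + z₂ • b 2 + z₃ • b 3)
    (h3 : A (b 3) = w₁ • b 1 + w₂ • b 2 + w₃ • b 3) : x₀ = 0 := by
  refine eigenvalue_zero hA (LinearMap.ker (b.coord 0)) ?_ (v := b 0) (by simp) ?_
  · intro x hx
    obtain ⟨a₀, a₁, a₂, a₃, rfl⟩ := basis_four_expand b x
    simp at hx
    subst hx
    simp [h1, h2, h3]
  · simp [h0]

lemma conj_eq_self_im {z : ℂ} (h : cc z = z) : z.im = 0 := Complex.conj_eq_iff_im.1 h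

namespace MatchedBracket

variable {E : Type*} [AddCommGroup E] [Module ℂ E]
    {μ : E →ₗ[ℂ] E →ₗ[ℂ] E} {ρ : E →ₛₗ[starRingEnd ℂ] E →ₗ[ℂ] E} {ζ : E}

/-- As b₁ = N b₀ and b₂ = N b₁, the operators ρ b₁ and ρ b₂ are iterated commutators of N with ρ b₀,
so ρ b₀ determines ρ. Nilpotent words in N and ρ b₀ make ρ b₀ strictly triangular, and `mix` relates
what is left. -/
lemma normalForm_regular (h : MatchedBracket μ ρ) (b : Basis (Fin 4) ℂ E)
    (hζ : IsDistinguished μ ρ (b 3)) (hN0 : μ (b 3) (b 0) = b 1) (hN1 : μ (b 3) (b 1) = b 2)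
    (hN2 : μ (b 3) (b 2) = 0) (h01 : μ (b 0) (b 1) = 0) (h02 : μ (b 0) (b 2) = 0)
    (h12 : μ (b 1) (b 2) = 0) :
    ∃ (A F L m n : ℂ) (s : ℝ),
      NormalForm μ ρ b 1 0 1 0 A F (2 * A) (-A) L m n s ∧ n ≠ 0 ∧ L.im = 0 := by
  have hN3 : μ (b 3) (b 3) = 0 := h.alt _
  have hr1 : ∀ v, ρ (b 1) v = μ (b 3) (ρ (b 0) v) - ρ (b 0) (μ (b 3) v) := fun v => by
    rw [← hN0, h.rep, hζ.left]
  have hr2 : ∀ v, ρ (b 2) v = μ (b 3) (ρ (b 1) v) - ρ (b 1) (μ (b 3) v) := fun v => by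
    rw [← hN1, h.rep, hζ.left]
  have hR3 : ρ (b 0) (b 3) = 0 := hζ.right _
  obtain ⟨a₀, r₁₂, r₁₃, r₁, R0⟩ := basis_four_expand b (ρ (b 0) (b 0))
  obtain ⟨c₀, c₁, r₂₃, r₂, R1⟩ := basis_four_expand b (ρ (b 0) (b 1))
  obtain ⟨d₀, d₁, d₂, r₃, R2⟩ := basis_four_expand b (ρ (b 0) (b 2))
  -- N² ∘ ρ b₀ sends b₂ to d₀ b₂. The next coefficients are read off in the same way from N ∘ ρ b₀
  -- and from ρ b₀ itself.
  have hd0 : d₀ = 0 := by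
    refine eigenvalue_zero₀ (h.nil_three (b 3) (b 3) (b 0)) (b.ne_zero 2) ?_
    simp [hζ.left, R2, hN0, hN1, hN2, hN3]
  subst hd0
  have hd1 : d₁ = 0 := by
    refine eigenvalue_zero₀ (h.nil_two (b 3) (b 0)) (b.ne_zero 2) ?_
    simp [hζ.left, R2, hN1, hN2, hN3]
  subst hd1
  have ne12 : ∀ t : ℂ, b 1 ≠ t • b 2 := fun t ht => by
    have := basis_four_indep b (a₀ := 0) (a₁ := 1) (a₂ := -t) (a₃ := 0) (by rw [ht]; module)
    simp at this
  have ne23 : ∀ t : ℂ, b 2 ≠ t • b 3 := fun t ht => by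
    have := basis_four_indep b (a₀ := 0) (a₁ := 0) (a₂ := 1) (a₃ := -t) (by rw [ht]; module)
    simp at this
  have ne123 : ∀ t s : ℂ, b 1 ≠ t • b 2 + s • b 3 := fun t s ht => by
    have := basis_four_indep b (a₀ := 0) (a₁ := 1) (a₂ := -t) (a₃ := -s) (by rw [ht]; module)
    simp at this
  have hc0 : c₀ = 0 := by
    refine eigenvalue_zero₁ (h.nil_two (b 3) (b 0)) (u := b 2) (v := b 1) (e := 0) (d := c₁) ?_
      ne12 ?_
    · simp [hζ.left, R2, hN2, hN3]
    · simp [hζ.left, R1, hN0, hN1, hN2, hN3]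
  subst hc0
  have hd2 : d₂ = 0 := by
    refine eigenvalue_zero₁ (h.nil_one (b 0)) (u := b 3) (v := b 2) (e := 0) (d := r₃) ?_ ne23 ?_
    · simp [hR3]
    · simp [R2]
  subst hd2
  have hc1 : c₁ = 0 := by
    refine eigenvalue_zero₂ (h.nil_one (b 0)) (u := b 2) (w := b 3) (v := b 1)
      (e₁ := 0) (e₂ := r₃) (f₁ := 0) (f₂ := 0) (d₁ := r₂₃) (d₂ := r₂) ?_ ?_ ne123 ?_
    · simp [R2]
    · simp [hR3]
    · simp [R1]
  subst hc1
  have ha0 : a₀ = 0 := by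
    refine eigenvalue_zero_coord (h.nil_one (b 0)) b (y₁ := 0) (y₂ := r₂₃) (y₃ := r₂) (z₁ := 0)
      (z₂ := 0) (z₃ := r₃) (w₁ := 0) (w₂ := 0) (w₃ := 0) R0 ?_ ?_ ?_
    · simp [R1]
    · simp [R2]
    · simp [hR3]
  subst ha0
  simp only [zero_smul, zero_add] at R0 R1 R2
  have S0 : ρ (b 1) (b 0) = (r₁₂ - r₂₃) • b 2 - r₂ • b 3 := by
    rw [hr1, R0, hN0, R1]; simp only [map_add, map_smul, hN1, hN2, hN3]; module
  have S1 : ρ (b 1) (b 1) = -r₃ • b 3 := by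
    rw [hr1, R1, hN1, R2]; simp only [map_add, map_smul, hN2, hN3]; module
  have S2 : ρ (b 1) (b 2) = 0 := by
    rw [hr1, R2, hN2]; simp only [map_smul, hN3, map_zero]; module
  have S3 : ρ (b 1) (b 3) = 0 := hζ.right _
  have T0 : ρ (b 2) (b 0) = r₃ • b 3 := by
    rw [hr2, S0, hN0, S1]; simp only [map_sub, map_smul, hN2, hN3]; module
  have T1 : ρ (b 2) (b 1) = 0 := by
    rw [hr2, S1, hN1, S2]; simp only [map_smul, hN3]; module
  have T2 : ρ (b 2) (b 2) = 0 := by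
    rw [hr2, S2, hN2]; simp
  have T3 : ρ (b 2) (b 3) = 0 := hζ.right _
  have h11 : μ (b 1) (b 1) = 0 := h.alt _
  have h22 : μ (b 2) (b 2) = 0 := h.alt _
  have h03 : μ (b 0) (b 3) = -b 1 := by rw [h.skew, hN0]
  have h20 : μ (b 2) (b 0) = 0 := by rw [h.skew, h02, neg_zero]
  have h21 : μ (b 2) (b 1) = 0 := by rw [h.skew, h12, neg_zero]
  have E1 := h.mix (b 0) (b 1) (b 0)
  rw [h01, R0, R1, S0] at E1
  simp only [map_add, map_sub, map_smul, map_smulₛₗ, LinearMap.add_apply, LinearMap.sub_apply,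
    LinearMap.smul_apply, h11, h21, h02, h03, hζ.left, hN1, hN0, S1, T1, T0, map_zero] at E1
  obtain ⟨-, e1, e2, e3⟩ := basis_four_indep b (a₀ := 0) (a₁ := -r₂ - cc r₂)
    (a₂ := r₁ - cc r₁) (a₃ := r₃ * cc (2 * r₁₂ - r₂₃)) (by
      simp only [cc, map_sub, map_mul, map_ofNat]
      linear_combination (norm := module) -E1)
  have E2 := h.mix (b 0) (b 2) (b 0)
  rw [h02, R0, R2, T0] at E2
  simp only [map_add, map_smul, map_smulₛₗ, LinearMap.add_apply,
    LinearMap.smul_apply, h12, h22, h03, hζ.left, hN0, hN2, S2, T2, map_zero] at E2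
  obtain ⟨-, e4, -, -⟩ := basis_four_indep b (a₀ := 0) (a₁ := cc r₃ - r₃)
    (a₂ := 0) (a₃ := 0) (by
      simp only [cc]
      linear_combination (norm := module) -E2)
  -- If r₃ = 0, then b₂ is annihilated on all sides, against SnN.
  have hr3 : r₃ ≠ 0 := by
    rintro rfl
    refine b.ne_zero 2 (h.snn (b 2) ?_ ?_ ?_)
    · refine b.ext fun i => ?_
      fin_cases i <;> simp [h20, h21, h.alt, h.skew (b 2) (b 3), hN2]
    · refine b.ext fun i => ?_
      fin_cases i <;> simp [T0, T1, T2, T3]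
    · intro y
      obtain ⟨y₀, y₁, y₂, y₃, rfl⟩ := basis_four_expand b y
      simp [R2, S2, T2, hζ.left, hN2]
  have e3' : r₂₃ = 2 * r₁₂ := by
    have : cc (2 * r₁₂ - r₂₃) = 0 := (mul_eq_zero.1 e3).resolve_left hr3
    have := (map_eq_zero (starRingEnd ℂ)).1 this
    linear_combination -this
  have hr3' : cc r₃ = r₃ := by linear_combination e4
  have hr3r : ((r₃.re : ℝ) : ℂ) = r₃ := Complex.conj_eq_iff_re.1 hr3'
  have hr2' : cc (-r₂) = r₂ := by
    simp only [cc, map_neg]; linear_combination e1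
  refine ⟨r₁₂, r₁₃, r₁, -r₂, r₃, -r₃.re, ⟨hζ, ?_, h02, h12, ?_, ?_, hN2, R0, ?_, ?_, ?_, ?_, S2,
    T0, T1, T2⟩, hr3, conj_eq_self_im (by linear_combination -e2)⟩
  · rw [h01]; module
  · rw [hN0]; module
  · rw [hN1]; module
  · rw [R1, e3', hr2']
  · rw [R2, hr3']
  · rw [S0, e3']; module
  · rw [S1]; push_cast; rw [hr3r]

end MatchedBracket

end NilComplex

/-! ### The rank-one case: first restrictions on μ and ρ -/

namespace NilComplex

open Module

namespace MatchedBracket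

variable {E : Type*} [AddCommGroup E] [Module ℂ E]
    {μ : E →ₗ[ℂ] E →ₗ[ℂ] E} {ρ : E →ₛₗ[starRingEnd ℂ] E →ₗ[ℂ] E} {ζ : E}

/-- The range of N = μ ζ lies in its kernel, strictly, because ζ is in the kernel and not in the
range. By rank–nullity the kernel has dimension at least 3, hence contains a vector outside the span
of NY and ζ. -/
lemma exists_basis_rank_one (h : MatchedBracket μ ρ) (hE : finrank ℂ E = 4)
    (hζ : IsDistinguished μ ρ ζ) (hsq : ∀ v, μ ζ (μ ζ v) = 0) {Y : E} (hY : μ ζ Y ≠ 0) :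
    ∃ b : Basis (Fin 4) ℂ E, b 3 = ζ ∧ μ ζ (b 0) = b 2 ∧ μ ζ (b 1) = 0 ∧ μ ζ (b 2) = 0 := by
  have : FiniteDimensional ℂ E := FiniteDimensional.of_finrank_pos (by omega)
  have hNζ : μ ζ ζ = 0 := h.alt ζ
  have hlt : LinearMap.range (μ ζ) < LinearMap.ker (μ ζ) := by
    refine lt_of_le_of_ne ?_ ?_
    · rintro _ ⟨v, rfl⟩
      exact hsq v
    · intro e
      have : ζ ∈ LinearMap.ker (μ ζ) := hNζ
      rw [← e] at this
      obtain ⟨w, hw⟩ := this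
      have := h.dist_not_range hζ (w := w) (c := 1) (by rw [hw, one_smul])
      simp at this
  have h1 := Submodule.finrank_lt_finrank_of_lt hlt
  have h2 := LinearMap.finrank_range_add_finrank_ker (μ ζ)
  rw [hE] at h2
  obtain ⟨S, hS, hS'⟩ : ∃ S ∈ LinearMap.ker (μ ζ), S ∉ Submodule.span ℂ {μ ζ Y, ζ} := by
    by_contra! hcon
    have h3 : LinearMap.ker (μ ζ) ≤ Submodule.span ℂ {μ ζ Y, ζ} := hcon
    have h4 := Submodule.finrank_mono h3
    have h5 : finrank ℂ (Submodule.span ℂ ({μ ζ Y, ζ} : Set E)) ≤ 2 := by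
      classical
      have := finrank_span_finset_le_card (R := ℂ) ({μ ζ Y, ζ} : Finset E)
      simp only [Finset.coe_insert, Finset.coe_singleton] at this
      exact this.trans Finset.card_le_two
    omega
  have hS0 : μ ζ S = 0 := hS
  obtain ⟨b, h0, h1, h2, h3⟩ := exists_basis_four hE Y S (μ ζ Y) ζ (by
    intro x y z w e
    have hx : x = 0 := by
      have := congrArg (μ ζ) e
      simpa [hS0, hsq, hNζ, hY] using this
    subst hx
    have hy : y = 0 := by
      by_contra hy
      refine hS' (Submodule.mem_span_pair.2 ⟨-(y⁻¹ * z), -(y⁻¹ * w), ?_⟩)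
      have : y⁻¹ • ((0 : ℂ) • Y + y • S + z • μ ζ Y + w • ζ) = 0 := by rw [e, smul_zero]
      simp only [smul_add, smul_smul, inv_mul_cancel₀ hy] at this
      linear_combination (norm := module) -this
    subst hy
    have hw : w = 0 := by
      have : μ ζ (z • Y) = (-w) • ζ := by
        rw [map_smul]; linear_combination (norm := module) e
      simpa using h.dist_not_range hζ this
    subst hw
    exact ⟨rfl, rfl, by simpa [hY] using e, rfl⟩)
  exact ⟨b, h3, by rw [h0, h2], by rw [h1, hS0], by rw [h2, hsq]⟩

/-- Applying the derivation N to μ(b₀, b₁) and μ(b₀, b₂) detects their b₀-components: the first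
becomes an eigenvalue of μ b₁ on b₂, the second must vanish outright. -/
lemma rank_one_bracket (h : MatchedBracket μ ρ) (b : Basis (Fin 4) ℂ E)
    (hN0 : μ (b 3) (b 0) = b 2) (hN1 : μ (b 3) (b 1) = 0) (hN2 : μ (b 3) (b 2) = 0) :
    μ (b 1) (b 2) = 0 ∧
    (∃ c₁ c₂ c₃ : ℂ, μ (b 0) (b 1) = c₁ • b 1 + c₂ • b 2 + c₃ • b 3) ∧
    ∃ d₁ d₂ d₃ : ℂ, μ (b 0) (b 2) = d₁ • b 1 + d₂ • b 2 + d₃ • b 3 := by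
  have hN3 : μ (b 3) (b 3) = 0 := h.alt _
  obtain ⟨c₀, c₁, c₂, c₃, hc⟩ := basis_four_expand b (μ (b 0) (b 1))
  obtain ⟨d₀, d₁, d₂, d₃, hd⟩ := basis_four_expand b (μ (b 0) (b 2))
  have h12 : μ (b 1) (b 2) = (-c₀) • b 2 := by
    have := h.jac (b 3) (b 0) (b 1)
    rw [hc, hN0, hN1, (μ (b 0)).map_zero, add_zero, h.skew (b 2)] at this
    simp only [map_add, map_smul, hN0, hN1, hN2, hN3] at this
    linear_combination (norm := module) this
  have hc0 : c₀ = 0 := by simpa using eigenvalue_zero₀ (h.nilμ (b 1)) (b.ne_zero 2) h12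
  have hd0 : d₀ = 0 := by
    have := h.jac (b 3) (b 0) (b 2)
    rw [hd, hN0, hN2, (μ (b 0)).map_zero, add_zero, h.alt (b 2)] at this
    simp only [map_add, map_smul, hN0, hN1, hN2, hN3] at this
    have h1 : d₀ • b 2 = 0 := by linear_combination (norm := module) this
    exact (smul_eq_zero.1 h1).resolve_right (b.ne_zero 2)
  subst hc0 hd0
  exact ⟨by rw [h12]; module, ⟨c₁, c₂, c₃, by rw [hc]; module⟩, d₁, d₂, d₃, by rw [hd]; module⟩

/-- N b₁ = 0 makes ρ b₁ commute with N, while b₂ = N b₀ makes ρ b₂ the commutator of N and ρ b₀.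
Vanishing eigenvalues and one instance of `mix` then remove every b₀-component. -/
lemma rank_one_rep (h : MatchedBracket μ ρ) (b : Basis (Fin 4) ℂ E)
    (hζ : IsDistinguished μ ρ (b 3))
    (hN0 : μ (b 3) (b 0) = b 2) (hN1 : μ (b 3) (b 1) = 0) (hN2 : μ (b 3) (b 2) = 0) :
    ρ (b 1) (b 2) = 0 ∧ ρ (b 2) (b 0) = -ρ (b 0) (b 2) ∧ ρ (b 2) (b 1) = 0 ∧ ρ (b 2) (b 2) = 0 ∧
    (∃ s₁ s₂ s₃ : ℂ, ρ (b 0) (b 0) = s₁ • b 1 + s₂ • b 2 + s₃ • b 3) ∧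
    (∃ q₁ q₂ q₃ : ℂ, ρ (b 0) (b 1) = q₁ • b 1 + q₂ • b 2 + q₃ • b 3) ∧
    (∃ p₁ p₂ p₃ : ℂ, ρ (b 0) (b 2) = p₁ • b 1 + p₂ • b 2 + p₃ • b 3) ∧
    (∃ u₁ u₂ u₃ : ℂ, ρ (b 1) (b 0) = u₁ • b 1 + u₂ • b 2 + u₃ • b 3) ∧
    ∃ u₄ u₅ : ℂ, ρ (b 1) (b 1) = u₄ • b 2 + u₅ • b 3 := by
  obtain ⟨h12, ⟨c₁, c₂, c₃, h01⟩, d₁, d₂, d₃, h02⟩ := h.rank_one_bracket b hN0 hN1 hN2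
  have hN3 : μ (b 3) (b 3) = 0 := h.alt _
  have hP3 : ρ (b 0) (b 3) = 0 := hζ.right _
  have hU3 : ρ (b 1) (b 3) = 0 := hζ.right _
  have hW3 : ρ (b 2) (b 3) = 0 := hζ.right _
  have hU : ∀ v, μ (b 3) (ρ (b 1) v) = ρ (b 1) (μ (b 3) v) := fun v => by
    have := h.rep (b 3) (b 1) v
    rw [hN1, hζ.left, map_zero, LinearMap.zero_apply] at this
    exact (sub_eq_zero.1 this.symm)
  have hW : ∀ v, ρ (b 2) v = μ (b 3) (ρ (b 0) v) - ρ (b 0) (μ (b 3) v) := fun v => by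
    rw [← hN0, h.rep, hζ.left]
  obtain ⟨s₀, s₁, s₂, s₃, P0⟩ := basis_four_expand b (ρ (b 0) (b 0))
  obtain ⟨q₀, q₁, q₂, q₃, P1⟩ := basis_four_expand b (ρ (b 0) (b 1))
  obtain ⟨p₀, p₁, p₂, p₃, P2⟩ := basis_four_expand b (ρ (b 0) (b 2))
  obtain ⟨u₀, u₁, u₂, u₃, U0⟩ := basis_four_expand b (ρ (b 1) (b 0))
  obtain ⟨v₀, v₁, u₄, u₅, U1⟩ := basis_four_expand b (ρ (b 1) (b 1))
  have U2 : ρ (b 1) (b 2) = u₀ • b 2 := by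
    rw [← hN0, ← hU, U0]; simp only [map_add, map_smul, hN0, hN1, hN2, hN3]; module
  have hu0 : u₀ = 0 := eigenvalue_zero₀ (h.nil_one (b 1)) (b.ne_zero 2) U2
  subst hu0
  have hv0 : v₀ = 0 := by
    have := hU (b 1)
    rw [U1, hN1] at this
    simp only [map_add, map_smul, hN0, hN1, hN2, hN3, map_zero] at this
    have h1 : v₀ • b 2 = 0 := by linear_combination (norm := module) this
    exact (smul_eq_zero.1 h1).resolve_right (b.ne_zero 2)
  subst hv0
  have ne123 : ∀ t s : ℂ, b 1 ≠ t • b 2 + s • b 3 := fun t s ht => by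
    have := basis_four_indep b (a₀ := 0) (a₁ := 1) (a₂ := -t) (a₃ := -s) (by rw [ht]; module)
    simp at this
  have hv1 : v₁ = 0 := by
    refine eigenvalue_zero₂ (h.nil_one (b 1)) (u := b 2) (w := b 3) (v := b 1)
      (e₁ := 0) (e₂ := 0) (f₁ := 0) (f₂ := 0) (d₁ := u₄) (d₂ := u₅) ?_ ?_ ne123 ?_
    · simp [U2]
    · simp [hU3]
    · simp [U1]
  subst hv1
  have hp0 : p₀ = 0 := by
    refine eigenvalue_zero₀ (h.nil_two (b 3) (b 0)) (b.ne_zero 2) ?_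
    simp [hζ.left, P2, hN0, hN1, hN2, hN3]
  subst hp0
  have W0 : ρ (b 2) (b 0) = s₀ • b 2 - ρ (b 0) (b 2) := by
    rw [hW, P0, hN0]; simp only [map_add, map_smul, hN0, hN1, hN2, hN3]; module
  have W1 : ρ (b 2) (b 1) = q₀ • b 2 := by
    rw [hW, P1, hN1]; simp only [map_add, map_smul, hN0, hN1, hN2, hN3, map_zero]; module
  have W2 : ρ (b 2) (b 2) = 0 := by
    rw [hW, P2, hN2]; simp only [map_add, map_smul, hN0, hN1, hN2, hN3, map_zero]; module
  have h03 : μ (b 0) (b 3) = -b 2 := by rw [h.skew, hN0]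
  have h21 : μ (b 2) (b 1) = 0 := by rw [h.skew, h12, neg_zero]
  have h11 : μ (b 1) (b 1) = 0 := h.alt _
  -- The b₀-coordinate of this instance of `mix` reduces to |q₀|² = 0.
  have hq0 : q₀ = 0 := by
    have := congrArg (b.coord 0) (h.mix (b 0) (b 1) (b 1))
    rw [h01, U0, U1, P1] at this
    simp only [map_add, map_smul, map_smulₛₗ, map_sub, map_neg, LinearMap.add_apply,
      LinearMap.smul_apply, U1, U2, hU3, h11, h21, h02, h03, P1, W1, hζ.left, hN1, U0, W0, P2,
      hN0] at this
    simpa using this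
  subst hq0
  -- The span of b₁, b₂, b₃ is now invariant under ρ b₀, so s₀ is an eigenvalue on the quotient.
  have hs0 : s₀ = 0 := by
    refine eigenvalue_zero_coord (h.nil_one (b 0)) b (y₁ := q₁) (y₂ := q₂) (y₃ := q₃) (z₁ := p₁)
      (z₂ := p₂) (z₃ := p₃) (w₁ := 0) (w₂ := 0) (w₃ := 0) P0 ?_ ?_ ?_
    · simp [P1]
    · simp [P2]
    · simp [hP3]
  subst hs0
  refine ⟨by rw [U2]; module, by rw [W0]; module, by rw [W1]; module, W2,
    ⟨s₁, s₂, s₃, by rw [P0]; module⟩, ⟨q₁, q₂, q₃, by rw [P1]; module⟩,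
    ⟨p₁, p₂, p₃, by rw [P2]; module⟩, ⟨u₁, u₂, u₃, by rw [U0]; module⟩, u₄, u₅, by rw [U1]; module⟩

end MatchedBracket

end NilComplex

/-! ### Rank one, filiform subcase: μ(b₀, b₂) has a b₁-component -/

namespace NilComplex

open Module

/-- The vectors v, Av, A²v span an invariant subspace of dimension at most three, on which the cube
of a nilpotent operator vanishes. The proof reads the coefficients off with powers of A near the
last nonzero one. -/
lemma pow_three_apply_eq_zero {E : Type*} [AddCommGroup E] [Module ℂ E] {A : E →ₗ[ℂ] E}
    (hA : IsNilpotent A) {v : E} {x y z : ℂ} (hv : A (A v) ≠ 0)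
    (h : A (A (A v)) = x • A (A v) + y • A v + z • v) : A (A (A v)) = 0 := by
  obtain ⟨j, hj, hj'⟩ := MatchedBracket.exists_last_power hA (j := 2) (v := v)
    (by simpa [pow_two] using hv)
  have hshift : ∀ k w, (A ^ k) (A w) = (A ^ (k + 1)) w := fun k w => by
    rw [pow_succ, Module.End.mul_apply]
  have hbig : ∀ k, (A ^ (2 + j + 1 + k)) v = 0 := fun k => by
    rw [add_comm _ k, pow_add, Module.End.mul_apply, hj', map_zero]
  have hz : z = 0 := by
    have := congrArg (A ^ (2 + j)) h
    simp only [map_add, map_smul, hshift] at this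
    rw [show 2 + j + 1 + 1 + 1 = 2 + j + 1 + 2 by omega, hbig 2, hbig 1, hj'] at this
    simpa [hj] using this.symm
  have hy : y = 0 := by
    have := congrArg (A ^ (1 + j)) h
    simp only [map_add, map_smul, hshift] at this
    rw [show 1 + j + 1 + 1 + 1 = 2 + j + 1 + 1 by omega, hbig 1,
      show 1 + j + 1 + 1 = 2 + j + 1 by omega, hj', show 1 + j + 1 = 2 + j by omega, hz] at this
    simpa [hj] using this.symm
  have hx : x = 0 := by
    have := congrArg (A ^ j) h
    simp only [map_add, map_smul, hshift] at this
    rw [show j + 1 + 1 + 1 = 2 + j + 1 by omega, hj', show j + 1 + 1 = 2 + j by omega,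
      hz, hy] at this
    simpa [hj] using this.symm
  rw [h, hx, hy, hz]
  module

lemma pow_two_apply_eq_zero {E : Type*} [AddCommGroup E] [Module ℂ E] {A : E →ₗ[ℂ] E}
    (hA : IsNilpotent A) {v : E} {x y : ℂ}
    (h : A (A v) = x • A v + y • v) : A (A v) = 0 := by
  by_contra h0
  have h3 : A (A (A v)) = 0 := pow_three_apply_eq_zero hA (x := x) (y := y) (z := 0) h0
    (by conv_lhs => rw [h]
        simp only [map_add, map_smul]; module)
  have h4 : x • A (A v) + y • A v = 0 := by
    have := congrArg A h
    rw [h3] at this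
    simpa using this.symm
  have hy : y = 0 := by
    have := congrArg A h4
    simpa [h3, h0] using this
  have hx : x = 0 := by simpa [hy, h0] using h4
  exact h0 (by rw [h, hx, hy]; module)

namespace MatchedBracket

variable {E : Type*} [AddCommGroup E] [Module ℂ E]
    {μ : E →ₗ[ℂ] E →ₗ[ℂ] E} {ρ : E →ₛₗ[starRingEnd ℂ] E →ₗ[ℂ] E} {ζ : E}

/-- Taking μ(b₀, b₂) as the new b₁ gives the chain ζ ↦ −b₂ ↦ −b₁ under μ b₀. Its span is invariant
of dimension three, so nilpotency ends the chain there. -/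
lemma exists_basis_filiform (h : MatchedBracket μ ρ) (hE : finrank ℂ E = 4)
    (b : Basis (Fin 4) ℂ E)
    (hN0 : μ (b 3) (b 0) = b 2) (hN2 : μ (b 3) (b 2) = 0)
    (h12 : μ (b 1) (b 2) = 0) {d₁ d₂ d₃ : ℂ}
    (hN1 : μ (b 3) (b 1) = 0)
    (h02 : μ (b 0) (b 2) = d₁ • b 1 + d₂ • b 2 + d₃ • b 3) (hd : d₁ ≠ 0) :
    ∃ b' : Basis (Fin 4) ℂ E, b' 3 = b 3 ∧ μ (b' 3) (b' 0) = b' 2 ∧ μ (b' 3) (b' 1) = 0 ∧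
      μ (b' 3) (b' 2) = 0 ∧ μ (b' 0) (b' 1) = 0 ∧ μ (b' 0) (b' 2) = b' 1 ∧
      μ (b' 1) (b' 2) = 0 := by
  have hN3 : μ (b 3) (b 3) = 0 := h.alt _
  have h22 : μ (b 2) (b 2) = 0 := h.alt _
  have h03 : μ (b 0) (b 3) = -b 2 := by rw [h.skew, hN0]
  obtain ⟨-, ⟨c₁, c₂, c₃, h01⟩, -⟩ := h.rank_one_bracket b hN0 hN1 hN2
  obtain ⟨b', hb0, hb1, hb2, hb3⟩ := exists_basis_four hE (b 0) (μ (b 0) (b 2)) (b 2) (b 3) (by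
    intro x y z w e
    rw [h02] at e
    obtain ⟨hx, hy, hz, hw⟩ := basis_four_indep b (a₀ := x) (a₁ := y * d₁) (a₂ := z + y * d₂)
      (a₃ := w + y * d₃) (by linear_combination (norm := module) e)
    have hy' : y = 0 := (mul_eq_zero.1 hy).resolve_right hd
    subst hy'
    exact ⟨hx, rfl, by simpa using hz, by simpa using hw⟩)
  refine ⟨b', hb3, by rw [hb3, hb0, hb2, hN0], ?_, by rw [hb3, hb2, hN2], ?_,
    by rw [hb0, hb1, hb2], ?_⟩
  · rw [hb3, hb1, h02]; simp [hN1, hN2, hN3]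
  · rw [hb0, hb1]
    have h2 : μ (b 0) (μ (b 0) (b 3)) = -μ (b 0) (b 2) := by rw [h03, map_neg]
    have hne : μ (b 0) (b 2) ≠ 0 := by
      rw [← hb1]; exact b'.ne_zero 1
    -- These coefficients write the third iterate on ζ through the lower ones, the old b₁ being
    -- eliminated by means of the second iterate.
    have := pow_three_apply_eq_zero (h.nilμ (b 0)) (v := b 3) (x := d₂ + c₁)
      (y := d₁ * c₂ - c₁ * d₂ - d₃) (z := -(d₁ * c₃ - c₁ * d₃)) (by rw [h2]; simpa using hne) ?_
    · rw [h2, map_neg] at this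
      simpa using this
    · rw [h2, h03, h02]
      simp only [map_neg, map_add, map_smul, h01, h02, h03]
      module
  · rw [hb1, hb2, h02]; simp [h12, h22, hN2]

/-- Since b₁ = μ(b₀, b₂), ρ b₁ is the commutator of ρ b₀ and ρ b₂; as ρ b₂ comes from N and ρ b₀,
everything depends on ρ b₀ alone. -/
lemma normalForm_filiform (h : MatchedBracket μ ρ) (b : Basis (Fin 4) ℂ E)
    (hζ : IsDistinguished μ ρ (b 3))
    (hN0 : μ (b 3) (b 0) = b 2) (hN1 : μ (b 3) (b 1) = 0) (hN2 : μ (b 3) (b 2) = 0)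
    (h01 : μ (b 0) (b 1) = 0) (h02 : μ (b 0) (b 2) = b 1) (h12 : μ (b 1) (b 2) = 0) :
    ∃ (b' : Basis (Fin 4) ℂ E) (A F p L m n : ℂ), b' 3 = b 3 ∧
      NormalForm μ ρ b' 1 0 0 1 A F p (-p) L m n 0 ∧ n ≠ 0 ∧ p ≠ 0 := by
  obtain ⟨U2, W0, W1, W2, ⟨s₁, s₂, s₃, P0⟩, ⟨q₁, q₂, q₃, P1⟩, ⟨p₁, p₂, p₃, P2⟩, -, u₄, u₅, U1⟩ :=
    h.rank_one_rep b hζ hN0 hN1 hN2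
  have hP3 : ρ (b 0) (b 3) = 0 := hζ.right _
  have hU3 : ρ (b 1) (b 3) = 0 := hζ.right _
  have hW3 : ρ (b 2) (b 3) = 0 := hζ.right _
  have hU : ∀ v, ρ (b 1) v = ρ (b 0) (ρ (b 2) v) - ρ (b 2) (ρ (b 0) v) := fun v => by
    rw [← h.rep, h02]
  have U1' : ρ (b 1) (b 1) = 0 := by
    rw [hU, W1, P1]; simp [W1, W2, hW3]
  -- Modulo ζ, ρ b₀ preserves the plane of b₁ and b₂. Which of the two is the deeper vector is not
  -- known yet, so only trace and determinant are available.
  obtain ⟨htr, hdet⟩ := trace_det_zero (h.nil_one (b 0)) (Submodule.span ℂ {b 3})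
    (v := b 1) (w := b 2) (a := q₁) (b := q₂) (c := p₁) (d := p₂)
    (by
      intro x hx
      obtain ⟨t, rfl⟩ := Submodule.mem_span_singleton.1 hx
      simp [hP3])
    (by
      intro x y hxy
      obtain ⟨t, ht⟩ := Submodule.mem_span_singleton.1 hxy
      obtain ⟨-, hx, hy, -⟩ := basis_four_indep b (a₀ := 0) (a₁ := x) (a₂ := y) (a₃ := -t)
        (by rw [neg_smul, ht]; module)
      exact ⟨hx, hy⟩)
    (Submodule.mem_span_singleton.2 ⟨q₃, by rw [P1]; module⟩)
    (Submodule.mem_span_singleton.2 ⟨p₃, by rw [P2]; module⟩)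
  have hq1 : q₁ = -p₂ := by linear_combination htr
  subst hq1
  have U0 : ρ (b 1) (b 0) = -(p₁ * q₃ + p₂ * p₃) • b 3 := by
    have e1 : p₁ * q₂ + p₂ * p₂ = 0 := by linear_combination -hdet
    rw [hU, W0, P0, P2]
    simp only [map_add, map_smul, map_neg, W1, W2, hW3, P1, P2, hP3]
    linear_combination (norm := module) congrArg (fun t => -t • b 2) e1
  have h03 : μ (b 0) (b 3) = -b 2 := by rw [h.skew, hN0]
  have h11 : μ (b 1) (b 1) = 0 := h.alt _
  have h22 : μ (b 2) (b 2) = 0 := h.alt _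
  have h10 : μ (b 1) (b 0) = 0 := by rw [h.skew, h01, neg_zero]
  have h21 : μ (b 2) (b 1) = 0 := by rw [h.skew, h12, neg_zero]
  have E1 := h.mix (b 0) (b 2) (b 0)
  rw [h02, P0, P1, W0, P2] at E1
  simp only [map_add, map_neg, map_smul, map_smulₛₗ, LinearMap.add_apply, LinearMap.neg_apply,
    LinearMap.smul_apply, h12, h22, hN2, h01, h02, h03, hζ.left, hN0, U2, W2, U0, W0, P2] at E1
  obtain ⟨-, e1, e2, e3⟩ := basis_four_indep b (a₀ := 0) (a₁ := -p₂ - p₂ - cc p₂ * p₁)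
    (a₂ := q₂ + p₃ + cc p₃ - cc p₂ * p₂)
    (a₃ := q₃ - cc p₁ * (p₁ * q₃ + p₂ * p₃) - cc p₂ * p₃) (by
      simp only [cc]
      linear_combination (norm := module) E1)
  have E2 := h.mix (b 0) (b 1) (b 0)
  rw [h01, P0, P1, U0] at E2
  simp only [map_add, map_neg, map_zero, map_smul, map_smulₛₗ, LinearMap.add_apply,
    LinearMap.smul_apply, h11, h21, hN1, h01, h02, h03, hζ.left, hN0, U1', W1] at E2
  obtain ⟨-, e4, e5, -⟩ := basis_four_indep b (a₀ := 0) (a₁ := q₂)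
    (a₂ := -q₃ - cc (p₁ * q₃ + p₂ * p₃)) (a₃ := 0) (by
      simp only [cc, map_add, map_mul] at E2 ⊢
      linear_combination (norm := module) -E2)
  subst e4
  have hp2 : p₂ = 0 := by
    have : p₂ * p₂ = 0 := by linear_combination -hdet
    exact mul_self_eq_zero.1 this
  subst hp2
  simp only [cc, map_zero, zero_mul, mul_zero, add_zero, sub_zero, zero_add, map_mul, neg_zero,
    zero_smul] at e2 e3 e5 P1 P2 U0
  have hq3 : q₃ ≠ 0 := by
    rintro rfl
    refine b.ne_zero 1 (h.snn (b 1) ?_ ?_ ?_)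
    · refine b.ext fun i => ?_
      fin_cases i <;> simp [h10, h11, h12, h.skew (b 1) (b 3), hN1]
    · refine b.ext fun i => ?_
      fin_cases i <;> simp [U0, U1', U2, hU3]
    · intro y
      obtain ⟨y₀, y₁, y₂, y₃, rfl⟩ := basis_four_expand b y
      simp [P1, U1', W1, hζ.left, hN1]
  -- The relation `e3` now reads q₃ = |p₁|² q₃.
  have hp1 : p₁ ≠ 0 := by
    rintro rfl
    exact hq3 (by linear_combination e3)
  have hcq : cc q₃ = -(p₁ * q₃) := by
    have := congrArg (starRingEnd ℂ) e5
    simp only [map_sub, map_neg, map_mul, Complex.conj_conj, map_zero] at this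
    linear_combination -this
  have hcp : cc (-p₃) = p₃ := by
    simp only [cc, map_neg]; linear_combination -e2
  -- The normal form with β = 1, ε = 0 has N b₀ in position 1, whereas here it is b₂; hence the
  -- swap.
  refine ⟨b.reindex (Equiv.swap 1 2), s₂, s₁, p₁, s₃, -p₃, cc q₃, ?_⟩
  have i0 : b.reindex (Equiv.swap 1 2) 0 = b 0 := by simp [Equiv.swap_apply_def]
  have i1 : b.reindex (Equiv.swap 1 2) 1 = b 2 := by simp
  have i2 : b.reindex (Equiv.swap 1 2) 2 = b 1 := by simp
  have i3 : b.reindex (Equiv.swap 1 2) 3 = b 3 := by simp [Equiv.swap_apply_def]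
  refine ⟨i3, ?_, by simpa using hq3, hp1⟩
  constructor <;> simp only [i0, i1, i2, i3]
  · exact hζ
  · rw [h02]; module
  · exact h01
  · exact h21
  · rw [hN0]; module
  · rw [hN2]; module
  · exact hN1
  · rw [P0]; module
  · rw [P2, hcp]
  · rw [P1, cc, cc, Complex.conj_conj]
  · rw [W0, P2]; module
  · rw [W2]; simp
  · exact W1
  · rw [U0, hcq]
  · exact U2
  · exact U1'

end MatchedBracket

end NilComplex

/-! ### Rank one, non-filiform subcase -/

namespace NilComplex

open Module

namespace MatchedBracket

variable {E : Type*} [AddCommGroup E] [Module ℂ E]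
    {μ : E →ₗ[ℂ] E →ₗ[ℂ] E} {ρ : E →ₛₗ[starRingEnd ℂ] E →ₗ[ℂ] E} {ζ : E}

/-- Here μ b₀ preserves the span of ζ and b₂ and is nilpotent there, which forces μ(b₀, b₂) = 0. The
b₂-component of μ(b₀, b₁) is absorbed by adding a multiple of ζ to b₁; the multiple d of ζ is
excluded only later, by the identities for ρ. -/
lemma exists_basis_nonfiliform (h : MatchedBracket μ ρ) (hE : finrank ℂ E = 4)
    (b : Basis (Fin 4) ℂ E)
    (hN0 : μ (b 3) (b 0) = b 2) (hN1 : μ (b 3) (b 1) = 0) (hN2 : μ (b 3) (b 2) = 0)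
    (h12 : μ (b 1) (b 2) = 0) {d₂ d₃ : ℂ} (h02 : μ (b 0) (b 2) = d₂ • b 2 + d₃ • b 3) :
    ∃ (b' : Basis (Fin 4) ℂ E) (d : ℂ), b' 3 = b 3 ∧ μ (b' 3) (b' 0) = b' 2 ∧
      μ (b' 3) (b' 1) = 0 ∧ μ (b' 3) (b' 2) = 0 ∧ μ (b' 0) (b' 1) = d • b' 3 ∧
      μ (b' 0) (b' 2) = 0 ∧ μ (b' 1) (b' 2) = 0 := by
  have hN3 : μ (b 3) (b 3) = 0 := h.alt _
  have h03 : μ (b 0) (b 3) = -b 2 := by rw [h.skew, hN0]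
  obtain ⟨-, ⟨c₁, c₂, c₃, h01⟩, -⟩ := h.rank_one_bracket b hN0 hN1 hN2
  have h02' : μ (b 0) (b 2) = 0 := by
    have := pow_two_apply_eq_zero (h.nilμ (b 0)) (v := b 3) (x := d₂) (y := -d₃)
      (by rw [h03, map_neg, h02]; module)
    rw [h03, map_neg] at this
    simpa using this
  have hc1 : c₁ = 0 := by
    refine eigenvalue_zero₂ (h.nilμ (b 0)) (u := b 2) (w := b 3) (v := b 1)
      (e₁ := 0) (e₂ := 0) (f₁ := -1) (f₂ := 0) (d₁ := c₂) (d₂ := c₃) ?_ ?_ ?_ ?_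
    · simp [h02']
    · simp [h03]
    · intro t s ht
      have := basis_four_indep b (a₀ := 0) (a₁ := 1) (a₂ := -t) (a₃ := -s) (by rw [ht]; module)
      simp at this
    · rw [h01]
  subst hc1
  obtain ⟨b', hb0, hb1, hb2, hb3⟩ := exists_basis_four hE (b 0) (b 1 + c₂ • b 3) (b 2) (b 3) (by
    intro x y z w e
    obtain ⟨rfl, rfl, rfl, hw⟩ := basis_four_indep b (a₀ := x) (a₁ := y) (a₂ := z)
      (a₃ := w + y * c₂) (by linear_combination (norm := module) e)
    exact ⟨rfl, rfl, rfl, by simpa using hw⟩)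
  refine ⟨b', c₃, hb3, by rw [hb3, hb0, hb2, hN0], ?_, by rw [hb3, hb2, hN2], ?_,
    by rw [hb0, hb2, h02'], ?_⟩
  · rw [hb3, hb1]; simp [hN1, hN3]
  · rw [hb0, hb1, hb3, map_add, map_smul, h01, h03]; module
  · rw [hb1, hb2]; simp [h12, hN2]

/-- Put v = ρ(b₀, b₂). If p₁ ≠ 0, the identities force v − p₃ ζ to be annihilated on all sides; by
SnN it is zero, but its b₁-coordinate is p₁. -/
lemma rep_coeff_zero_of_nonfiliform (h : MatchedBracket μ ρ) (b : Basis (Fin 4) ℂ E)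
    (hζ : IsDistinguished μ ρ (b 3))
    (hN0 : μ (b 3) (b 0) = b 2) (hN1 : μ (b 3) (b 1) = 0) (hN2 : μ (b 3) (b 2) = 0) {d : ℂ}
    (h01 : μ (b 0) (b 1) = d • b 3) (h02 : μ (b 0) (b 2) = 0) (h12 : μ (b 1) (b 2) = 0)
    {p₁ p₂ p₃ : ℂ} (P2 : ρ (b 0) (b 2) = p₁ • b 1 + p₂ • b 2 + p₃ • b 3) : p₁ = 0 := by
  obtain ⟨U2, W0, W1, W2, ⟨s₁, s₂, s₃, P0⟩, ⟨q₁, q₂, q₃, P1⟩, -, ⟨u₁, u₂, u₃, U0⟩, u₄, u₅, U1⟩ :=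
    h.rank_one_rep b hζ hN0 hN1 hN2
  by_contra hp
  have hP3 : ρ (b 0) (b 3) = 0 := hζ.right _
  have hU3 : ρ (b 1) (b 3) = 0 := hζ.right _
  have hW3 : ρ (b 2) (b 3) = 0 := hζ.right _
  have hN3 : μ (b 3) (b 3) = 0 := h.alt _
  have h03 : μ (b 0) (b 3) = -b 2 := by rw [h.skew, hN0]
  have h11 : μ (b 1) (b 1) = 0 := h.alt _
  have h22 : μ (b 2) (b 2) = 0 := h.alt _
  have h21 : μ (b 2) (b 1) = 0 := by rw [h.skew, h12, neg_zero]
  have h13 : μ (b 1) (b 3) = 0 := by rw [h.skew, hN1, neg_zero]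
  have h23 : μ (b 2) (b 3) = 0 := by rw [h.skew, hN2, neg_zero]
  have U1' : ρ (b 1) (b 1) = 0 := by
    have := h.rep (b 2) (b 1) (b 0)
    rw [h21, map_zero, LinearMap.zero_apply, U0, W0, P2] at this
    simp only [map_add, map_smul, map_neg, W1, W2, hW3, U2, hU3, smul_zero, add_zero] at this
    have h1 : p₁ • ρ (b 1) (b 1) = 0 := by linear_combination (norm := module) -this
    exact (smul_eq_zero.1 h1).resolve_left hp
  have hPP : ρ (b 0) (ρ (b 0) (b 2)) = 0 := by
    have := h.rep (b 0) (b 2) (b 0)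
    rw [h02, map_zero, LinearMap.zero_apply, P0, W0] at this
    simp only [map_add, map_smul, map_neg, W1, W2, hW3, smul_zero, add_zero, sub_zero] at this
    exact neg_eq_zero.1 this.symm
  set v := ρ (b 0) (b 2) with hv
  have hQv : μ (b 0) v = (p₁ * d) • b 3 - p₃ • b 2 := by
    rw [P2]; simp only [map_add, map_smul, h01, h02, h03]; module
  -- This instance of `mix` turns ρ v into a known bracket; a second instance, with v as an
  -- argument, yields p₃ + conj p₃ = 0 and p₁ d = 0.
  have hVY : ρ v (b 0) = μ (b 0) v := by
    have := h.mix (b 0) (b 2) (b 0)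
    rw [h02, P0, W0, ← hv] at this
    simp only [map_add, map_neg, map_zero, map_smul, map_smulₛₗ, LinearMap.add_apply,
      LinearMap.neg_apply, LinearMap.smul_apply, h12, h22, hN2, hζ.left, U2, W2, smul_zero,
      add_zero, zero_add, sub_zero] at this
    exact (add_neg_eq_zero.1 this.symm).symm
  have hUv : ρ (b 1) v = 0 := by rw [P2]; simp [U1', U2, hU3]
  have hWv : ρ (b 2) v = 0 := by rw [P2]; simp [W1, W2, hW3]
  have hNv : μ (b 3) v = 0 := by rw [P2]; simp [hN1, hN2, hN3]
  have h1v : μ (b 1) v = 0 := by rw [P2]; simp [h11, h12, h13]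
  have h2v : μ (b 2) v = 0 := by rw [P2]; simp [h21, h22, h23]
  have E := h.mix (b 0) v (b 0)
  rw [hVY, hQv, hPP, P0] at E
  simp only [map_add, map_sub, map_zero, map_smul, map_smulₛₗ, LinearMap.add_apply,
    LinearMap.sub_apply, LinearMap.smul_apply, h1v, h2v, hNv, hUv, hWv, hζ.left, hN0, W0, hP3,
    ← hv] at E
  rw [P2] at E
  obtain ⟨-, e1, e2, -⟩ := basis_four_indep b (a₀ := 0) (a₁ := -(p₃ + cc p₃) * p₁)
    (a₂ := -(p₃ + cc p₃) * p₂ - cc (p₁ * d)) (a₃ := -(p₃ + cc p₃) * p₃) (by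
      simp only [cc]
      linear_combination (norm := module) E)
  have hp3 : p₃ + cc p₃ = 0 := neg_eq_zero.1 ((mul_eq_zero.1 e1).resolve_right hp)
  have hd : p₁ * d = 0 := by
    rw [hp3] at e2
    simpa [hp] using e2
  have hQv' : μ (b 0) v = -p₃ • b 2 := by rw [hQv, hd]; module
  have hzero : v - p₃ • b 3 = 0 := by
    refine h.snn _ ?_ ?_ ?_
    · refine b.ext fun i => ?_
      fin_cases i <;>
        simp [h.skew v, hQv', h1v, h2v, hNv, hN0, hN1, hN2, hN3]
    · have hv1 : ρ v (b 1) = 0 := by rw [P2]; simp [U1', W1, hζ.left, hN1]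
      have hv2 : ρ v (b 2) = 0 := by rw [P2]; simp [U2, W2, hζ.left, hN2]
      refine b.ext fun i => ?_
      fin_cases i
      · simp only [map_sub, map_smulₛₗ, LinearMap.sub_apply, LinearMap.smul_apply, hζ.left,
          LinearMap.zero_apply, Fin.zero_eta, hVY, hQv', hN0]
        simp only [cc] at hp3
        linear_combination (norm := module) congrArg (fun t => -t • b 2) hp3
      · simp [hv1, hζ.left, hN1]
      · simp [hv2, hζ.left, hN2]
      · simp [hζ.right]
    · intro y
      obtain ⟨y₀, y₁, y₂, y₃, rfl⟩ := basis_four_expand b y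
      simp [hPP, hUv, hWv, hζ.left, hNv, hζ.right, hN3]
  have := basis_four_indep b (a₀ := 0) (a₁ := p₁) (a₂ := p₂) (a₃ := 0) (by
    rw [P2] at hzero
    linear_combination (norm := module) hzero)
  exact hp this.2.1

/-- With p₁ gone, ρ b₀ is strictly triangular, and `mix` and `rep` determine the rest. SnN is used
twice: on b₂ for n ≠ 0, and on a combination of b₁ and b₂ to exclude p = s = 0. -/
lemma normalForm_nonfiliform (h : MatchedBracket μ ρ) (b : Basis (Fin 4) ℂ E)
    (hζ : IsDistinguished μ ρ (b 3))
    (hN0 : μ (b 3) (b 0) = b 2) (hN1 : μ (b 3) (b 1) = 0) (hN2 : μ (b 3) (b 2) = 0) {d : ℂ}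
    (h01 : μ (b 0) (b 1) = d • b 3) (h02 : μ (b 0) (b 2) = 0) (h12 : μ (b 1) (b 2) = 0) :
    ∃ (A F p q L m n : ℂ) (s : ℝ), NormalForm μ ρ b 0 1 0 0 A F p q L m n s ∧ n ≠ 0 ∧
      (p = 0 → s ≠ 0) := by
  obtain ⟨U2, W0, W1, W2, ⟨s₁, s₂, s₃, P0⟩, ⟨q₁, q₂, q₃, P1⟩, ⟨p₁, p₂, p₃, P2⟩,
    ⟨u₁, u₂, u₃, U0⟩, u₄, u₅, U1⟩ := h.rank_one_rep b hζ hN0 hN1 hN2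
  have hp1 := h.rep_coeff_zero_of_nonfiliform b hζ hN0 hN1 hN2 h01 h02 h12 P2
  subst hp1
  have hP3 : ρ (b 0) (b 3) = 0 := hζ.right _
  have hU3 : ρ (b 1) (b 3) = 0 := hζ.right _
  have hW3 : ρ (b 2) (b 3) = 0 := hζ.right _
  have hN3 : μ (b 3) (b 3) = 0 := h.alt _
  have h03 : μ (b 0) (b 3) = -b 2 := by rw [h.skew, hN0]
  have h11 : μ (b 1) (b 1) = 0 := h.alt _
  have h22 : μ (b 2) (b 2) = 0 := h.alt _
  have h20 : μ (b 2) (b 0) = 0 := by rw [h.skew, h02, neg_zero]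
  have h21 : μ (b 2) (b 1) = 0 := by rw [h.skew, h12, neg_zero]
  have hp2 : p₂ = 0 := by
    refine eigenvalue_zero₁ (h.nil_one (b 0)) (u := b 3) (v := b 2) (e := 0) (d := p₃) ?_ ?_ ?_
    · simp [hP3]
    · intro t ht
      have := basis_four_indep b (a₀ := 0) (a₁ := 0) (a₂ := 1) (a₃ := -t) (by rw [ht]; module)
      simp at this
    · rw [P2]; module
  subst hp2
  have hq1 : q₁ = 0 := by
    refine eigenvalue_zero₂ (h.nil_one (b 0)) (u := b 2) (w := b 3) (v := b 1)
      (e₁ := 0) (e₂ := p₃) (f₁ := 0) (f₂ := 0) (d₁ := q₂) (d₂ := q₃) ?_ ?_ ?_ ?_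
    · rw [P2]; module
    · simp [hP3]
    · intro t s ht
      have := basis_four_indep b (a₀ := 0) (a₁ := 1) (a₂ := -t) (a₃ := -s) (by rw [ht]; module)
      simp at this
    · rw [P1]
  subst hq1
  simp only [zero_smul, zero_add] at P1 P2
  have hp3 : p₃ ≠ 0 := by
    rintro rfl
    refine b.ne_zero 2 (h.snn (b 2) ?_ ?_ ?_)
    · refine b.ext fun i => ?_
      fin_cases i <;> simp [h20, h21, h22, h.skew (b 2) (b 3), hN2]
    · refine b.ext fun i => ?_
      fin_cases i <;> simp [W0, W1, W2, hW3, P2]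
    · intro y
      obtain ⟨y₀, y₁, y₂, y₃, rfl⟩ := basis_four_expand b y
      simp [P2, U2, W2, hζ.left, hN2]
  have E1 := h.mix (b 0) (b 2) (b 0)
  rw [h02, P0, W0, P2] at E1
  simp only [map_add, map_neg, map_zero, map_smul, map_smulₛₗ, LinearMap.add_apply,
    LinearMap.neg_apply, LinearMap.smul_apply, h12, h22, hN2, hζ.left, h03, hN0, U2, W2] at E1
  obtain ⟨-, -, e1, -⟩ := basis_four_indep b (a₀ := 0) (a₁ := 0) (a₂ := p₃ + cc p₃) (a₃ := 0) (by
      simp only [cc]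
      linear_combination (norm := module) E1)
  have E2 := h.mix (b 0) (b 1) (b 0)
  rw [h01, P0, U0, P1] at E2
  simp only [map_add, map_smul, map_smulₛₗ, LinearMap.add_apply,
    LinearMap.smul_apply, h11, h21, hN1, h02, h03, hζ.left, hN0, U0, U1,
    W0, W1, P2, hP3] at E2
  obtain ⟨-, e2, e3, e4⟩ := basis_four_indep b (a₀ := 0) (a₁ := cc u₁ * u₁)
    (a₂ := -q₃ - cc s₁ * u₄ + cc u₁ * u₂ + cc u₃)
    (a₃ := -(cc s₁ * u₅) + cc u₁ * u₃ - cc u₂ * p₃) (by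
      simp only [cc]
      linear_combination (norm := module) -E2)
  -- The relation is |u₁|² = 0.
  have hu1 : u₁ = 0 := by simpa using e2
  subst hu1
  have E3 := h.mix (b 0) (b 1) (b 1)
  rw [h01, P1, U0, U1] at E3
  simp only [map_add, map_smul, map_smulₛₗ, LinearMap.add_apply,
    LinearMap.smul_apply, h11, h21, hN1, h02, h03, hζ.left, hN0,
    W0, W1, P2, hU3] at E3
  obtain ⟨-, -, e5, e6⟩ := basis_four_indep b (a₀ := 0) (a₁ := 0) (a₂ := -u₅ + cc u₅)
    (a₃ := -(cc u₄ * p₃)) (by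
      simp only [cc]
      linear_combination (norm := module) -E3)
  have hu4 : u₄ = 0 := by simpa [hp3] using e6
  subst hu4
  have E4 := h.rep (b 0) (b 1) (b 0)
  rw [h01, P0, U0] at E4
  simp only [map_add, map_smul, map_smulₛₗ, LinearMap.smul_apply, hζ.left,
    hN0, P2, hP3, U1, U2, hU3] at E4
  obtain ⟨-, -, e7, e8⟩ := basis_four_indep b (a₀ := 0) (a₁ := 0) (a₂ := cc d)
    (a₃ := s₁ * u₅ - u₂ * p₃) (by
      simp only [cc]
      linear_combination (norm := module) E4)
  have hd : d = 0 := by simpa using e7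
  subst hd
  simp only [cc, map_zero, zero_mul, mul_zero, add_zero, sub_zero, zero_smul, zero_add] at *
  have hu5 : ((u₅.re : ℝ) : ℂ) = u₅ := Complex.conj_eq_iff_re.1 (by linear_combination e5)
  have hq3 : (starRingEnd ℂ) u₃ = q₃ := by linear_combination e3
  refine ⟨s₁, s₂, q₂, u₂, s₃, u₃, (starRingEnd ℂ) p₃, u₅.re, ?_, by simpa using hp3, ?_⟩
  · constructor
    · exact hζ
    · simpa using h01
    · exact h02
    · exact h12
    · rw [hN0]; module
    · rw [hN1]; module
    · exact hN2
    · exact P0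
    · rw [P1, cc, hq3]
    · rw [P2, cc, Complex.conj_conj]
    · exact U0
    · rw [U1, hu5]
    · exact U2
    · rw [W0, P2]
      linear_combination (norm := module) congrArg (fun t => -t • b 3) e1
    · exact W1
    · exact W2
  · intro hq2 hs
    subst hq2
    rw [hs, Complex.ofReal_zero] at hu5
    subst hu5
    have hu2 : u₂ = 0 := by simpa [hp3] using e8
    subst hu2
    have hq3' : (starRingEnd ℂ) q₃ = u₃ := by rw [← hq3, Complex.conj_conj]
    simp only [zero_smul, zero_add] at P1 U0 U1
    -- When p = s = 0, the relation `e8` gives u₂ = 0, so b₁ and b₂ act only into the line of ζ;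
    -- this combination cancels both actions.
    have hzero : p₃ • b 1 - q₃ • b 2 = 0 := by
      refine h.snn _ ?_ ?_ ?_
      · refine b.ext fun i => ?_
        fin_cases i <;>
          simp [h.skew (b 1) (b 0), h01, h20, h11, h21, h12, h22, h.skew (b 1) (b 3),
            h.skew (b 2) (b 3), hN1, hN2]
      · refine b.ext fun i => ?_
        fin_cases i
        · simp only [map_sub, map_smulₛₗ, LinearMap.sub_apply, LinearMap.smul_apply,
            LinearMap.zero_apply, Fin.zero_eta, U0, W0, P2, hq3']
          linear_combination (norm := module) congrArg (fun t => (t * u₃) • b 3) e1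
        · simp [U1, W1]
        · simp [U2, W2]
        · simp [hU3, hW3]
      · intro y
        obtain ⟨y₀, y₁, y₂, y₃, rfl⟩ := basis_four_expand b y
        have hcomm : p₃ • q₃ • b 3 - q₃ • p₃ • b 3 = 0 := by module
        simp [P1, P2, U1, U2, W1, W2, hζ.left, hN1, hN2, hcomm]
    have := basis_four_indep b (a₀ := 0) (a₁ := p₃) (a₂ := -q₃) (a₃ := 0) (by
      linear_combination (norm := module) hzero)
    exact hp3 this.2.1

/-- The equations for dim g₂ = 4 have opposite coefficients at ω¹² and ω^{1 2̄}, that is κ = q.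
Scaling b₁ makes q = 1; subtracting ζ/2 then moves half of it to κ, because N b₀ = b₂. -/
lemma normalForm_shift (h : MatchedBracket μ ρ) (hE : finrank ℂ E = 4) {b : Basis (Fin 4) ℂ E}
    {A F q L m n : ℂ} {s : ℝ}
    (hb : NormalForm μ ρ b 0 1 0 0 A F 0 q L m n s) (hq : q ≠ 0) (hs : s ≠ 0) :
    ∃ (b' : Basis (Fin 4) ℂ E) (A F L m : ℂ) (s : ℝ), b' 3 = b 3 ∧
      NormalForm μ ρ b' 0 1 0 (1 / 2) A F 0 (1 / 2) L m n s ∧ s ≠ 0 := by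
  have hqc : cc q ≠ 0 := by simpa [cc] using hq
  obtain ⟨b', hb0, hb1, hb2, hb3⟩ := exists_basis_four hE (b 0)
    ((cc q)⁻¹ • b 1 - (1 / 2 : ℂ) • b 3) (b 2) (b 3) (by
    intro x y z w e
    obtain ⟨rfl, hy, rfl, hw⟩ := basis_four_indep b (a₀ := x) (a₁ := y * (cc q)⁻¹) (a₂ := z)
      (a₃ := w - y * (1 / 2)) (by linear_combination (norm := module) e)
    have : y = 0 := (mul_eq_zero.1 hy).resolve_right (inv_ne_zero hqc)
    subst this
    exact ⟨rfl, rfl, rfl, by simpa using hw⟩)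
  have hN3 : μ (b 3) (b 3) = 0 := h.alt _
  have hN0 := hb.μ30
  have h03 : μ (b 0) (b 3) = -b 2 := by rw [h.skew, hN0]; module
  have hcc : (starRingEnd ℂ) (cc q)⁻¹ = q⁻¹ := by simp [cc]
  have hc2 : (starRingEnd ℂ) (1 / 2 : ℂ) = 1 / 2 := by
    rw [map_div₀, map_one, map_ofNat]
  refine ⟨b', A * cc q, F, L + A * cc q * (1 / 2), q⁻¹ * m, (Complex.normSq q)⁻¹ * s, hb3, ?_,
    mul_ne_zero (inv_ne_zero (by simpa using hq)) hs⟩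
  constructor <;> simp only [hb0, hb1, hb2, hb3]
  · exact hb.dist
  · rw [map_sub, map_smul, map_smul, hb.μ01, h03]; module
  · exact hb.μ02
  · simp [hb.μ12, hb.μ32]
  · rw [hN0]; module
  · simp [hb.μ31, hN3]
  · exact hb.μ32
  · rw [hb.ρ00]
    have : A = A * cc q * (cc q)⁻¹ := by field_simp
    linear_combination (norm := module) congrArg (fun t => t • b 1) this
  · rw [map_sub, map_smul, map_smul, hb.ρ01, hb.dist.right]
    simp only [cc, map_mul, map_inv₀]; module
  · exact hb.ρ02
  · simp only [map_sub, map_smulₛₗ, LinearMap.sub_apply, LinearMap.smul_apply, hb.ρ10, hcc, hc2,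
      hb.dist.left, hN0]
    have : q⁻¹ * q = 1 := inv_mul_cancel₀ hq
    linear_combination (norm := module) congrArg (fun t => t • b 2) this
  · simp only [map_sub, map_smulₛₗ, LinearMap.sub_apply, LinearMap.smul_apply, hb.ρ11, hcc, hc2,
      hb.dist.left, hb.μ31, hN3, hb.dist.right, RingHom.id_apply]
    have : ((((Complex.normSq q)⁻¹ * s : ℝ)) : ℂ) = q⁻¹ * (cc q)⁻¹ * s := by
      push_cast
      rw [← Complex.mul_conj, mul_inv]
    rw [this]; module
  · simp [hb.ρ12, hb.dist.left, hb.μ32]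
  · exact hb.ρ20
  · simp [hb.ρ21, hb.dist.right]
  · exact hb.ρ22

/-- The alternatives are, in order: N² ≠ 0; filiform; non-filiform with p ≠ 0; non-filiform with p =
0 and q ≠ 0, after the shift; non-filiform with p = q = 0. -/
theorem exists_normalForm (h : MatchedBracket μ ρ) (hE : finrank ℂ E = 4)
    (hζ : IsDistinguished μ ρ ζ) :
    ∃ (b : Basis (Fin 4) ℂ E) (β ε η κ A F p q L m n : ℂ) (s : ℝ), b 3 = ζ ∧
      NormalForm μ ρ b β ε η κ A F p q L m n s ∧ n ≠ 0 ∧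
      ((β = 1 ∧ ε = 0 ∧ η = 1 ∧ κ = 0 ∧ L.im = 0) ∨
       (β = 1 ∧ ε = 0 ∧ η = 0 ∧ p ≠ 0 ∧ s = 0) ∨
       (β = 0 ∧ ε = 1 ∧ η = 0 ∧ κ = 0 ∧ p ≠ 0) ∨
       (β = 0 ∧ ε = 1 ∧ η = 0 ∧ κ = 1 / 2 ∧ q = 1 / 2 ∧ p = 0 ∧ s ≠ 0) ∨
       (β = 0 ∧ ε = 1 ∧ η = 0 ∧ κ = 0 ∧ q = 0 ∧ p = 0 ∧ s ≠ 0)) := by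
  by_cases hsq : ∀ v, μ ζ (μ ζ v) = 0
  · obtain ⟨Y, hY⟩ : ∃ Y, μ ζ Y ≠ 0 := by
      by_contra! hcon
      have h0 : μ ζ = 0 := LinearMap.ext hcon
      exact hζ.ne_zero (h.snn ζ h0 (by rw [hζ.left, h0]) hζ.right)
    obtain ⟨b, rfl, hN0, hN1, hN2⟩ := h.exists_basis_rank_one hE hζ hsq hY
    obtain ⟨h12, -, d₁, d₂, d₃, h02⟩ := h.rank_one_bracket b hN0 hN1 hN2
    by_cases hd : d₁ = 0
    · subst hd
      obtain ⟨b', d, hb3, hN0, hN1, hN2, h01, h02, h12⟩ :=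
        h.exists_basis_nonfiliform hE b hN0 hN1 hN2 h12 (d₂ := d₂) (d₃ := d₃)
          (by rw [h02]; module)
      rw [← hb3] at hζ ⊢
      obtain ⟨A, F, p, q, L, m, n, s, hnf, hn, hs⟩ :=
        h.normalForm_nonfiliform b' hζ hN0 hN1 hN2 h01 h02 h12
      by_cases hp : p = 0
      · by_cases hq : q = 0
        · exact ⟨b', 0, 1, 0, 0, A, F, p, q, L, m, n, s, rfl, hnf, hn,
            .inr <| .inr <| .inr <| .inr ⟨rfl, rfl, rfl, rfl, hq, hp, hs hp⟩⟩
        · have hs' := hs hp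
          subst hp
          obtain ⟨c, A, F, L, m, s, hc, hnf, hs⟩ := h.normalForm_shift hE hnf hq hs'
          exact ⟨c, 0, 1, 0, 1 / 2, A, F, 0, 1 / 2, L, m, n, s, hc, hnf, hn,
            .inr <| .inr <| .inr <| .inl ⟨rfl, rfl, rfl, rfl, rfl, rfl, hs⟩⟩
      · exact ⟨b', 0, 1, 0, 0, A, F, p, q, L, m, n, s, rfl, hnf, hn,
          .inr <| .inr <| .inl ⟨rfl, rfl, rfl, rfl, hp⟩⟩
    · obtain ⟨b', hb3, hN0, hN1, hN2, h01, h02, h12⟩ :=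
        h.exists_basis_filiform hE b hN0 hN2 h12 hN1 h02 hd
      rw [← hb3] at hζ ⊢
      obtain ⟨c, A, F, p, L, m, n, hc, hnf, hn, hp⟩ :=
        h.normalForm_filiform b' hζ hN0 hN1 hN2 h01 h02 h12
      exact ⟨c, 1, 0, 0, 1, A, F, p, -p, L, m, n, 0, hc, hnf, hn,
        .inr <| .inl ⟨rfl, rfl, rfl, hp, rfl⟩⟩
  · push Not at hsq
    obtain ⟨Y, hY⟩ := hsq
    obtain ⟨b, hb3, hN0, hN1, hN2, h01, h02, h12⟩ := h.exists_basis_regular hE hζ hY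
    rw [← hb3] at hζ hN0 hN1 hN2 ⊢
    obtain ⟨A, F, L, m, n, s, hnf, hn, hL⟩ := h.normalForm_regular b hζ hN0 hN1 hN2 h01 h02 h12
    exact ⟨b, 1, 0, 1, 0, A, F, 2 * A, -A, L, m, n, s, rfl, hnf, hn,
      .inl ⟨rfl, rfl, rfl, rfl, hL⟩⟩

end MatchedBracket

end NilComplex

/-! ### Separating the Jacobi identity by type -/

namespace NilComplex

open Module

section Splitting

variable {E : Type*} [AddCommGroup E] [Module ℂ E]
    {μ : E →ₗ[ℂ] E →ₗ[ℂ] E} {ρ : E →ₛₗ[starRingEnd ℂ] E →ₗ[ℂ] E}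

set_option maxHeartbeats 4000000 in
-- Every term is linear or conjugate-linear in each of x, y, v, and the three identities are
-- components of different type. Replacing arguments by their multiples by i and averaging isolates
-- each type.
lemma splitting_eval
    (hJ : ∀ x y v,
      μ x (μ y v + ρ y v - ρ v y) + ρ x (μ y v + ρ y v - ρ v y) - ρ (μ y v + ρ y v - ρ v y) x =
      (μ (μ x y + ρ x y - ρ y x) v + ρ (μ x y + ρ x y - ρ y x) v
        - ρ v (μ x y + ρ x y - ρ y x)) +
      (μ y (μ x v + ρ x v - ρ v x) + ρ y (μ x v + ρ x v - ρ v x)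
        - ρ (μ x v + ρ x v - ρ v x) y)) (x y v : E) :
    μ x (μ y v) = μ (μ x y) v + μ y (μ x v) ∧
    ρ (μ x y) v = ρ x (ρ y v) - ρ y (ρ x v) ∧
    ρ v (μ x y) = μ x (ρ v y) - μ y (ρ v x) - ρ (ρ x v) y + ρ (ρ y v) x := by
  have h000 := hJ x y v
  have h100 := hJ (Complex.I • x) y v
  have h010 := hJ x (Complex.I • y) v
  have h001 := hJ x y (Complex.I • v)
  have h110 := hJ (Complex.I • x) (Complex.I • y) v
  have h101 := hJ (Complex.I • x) y (Complex.I • v)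
  have h011 := hJ x (Complex.I • y) (Complex.I • v)
  have h111 := hJ (Complex.I • x) (Complex.I • y) (Complex.I • v)
  simp only [map_add, map_sub, map_smul, map_smulₛₗ, LinearMap.add_apply, LinearMap.sub_apply,
    LinearMap.smul_apply, Complex.conj_I, map_neg] at h000 h100 h010 h001 h110 h101 h011 h111
  have hI : Complex.I ^ 2 = -1 := Complex.I_sq
  refine ⟨?_, ?_, ?_⟩
  -- The weights expand a product of projectors (1 ∓ iT)/2, where T substitutes i times one
  -- argument: minus keeps the linear part, plus the conjugate-linear part. The other two
  -- combinations follow the same rule, up to a global sign.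
  · linear_combination (norm := skip) (1 / 8 : ℂ) • h000 - (Complex.I / 8) • h100
      - (Complex.I / 8) • h010 - (Complex.I / 8) • h001 - (1 / 8 : ℂ) • h110 - (1 / 8 : ℂ) • h101
      - (1 / 8 : ℂ) • h011 + (Complex.I / 8) • h111
    clear hJ h000 h100 h010 h001 h110 h101 h011 h111
    match_scalars <;> grind
  · linear_combination (norm := skip) -(1 / 8 : ℂ) • h000 - (Complex.I / 8) • h100
      - (Complex.I / 8) • h010 + (Complex.I / 8) • h001 + (1 / 8 : ℂ) • h110 - (1 / 8 : ℂ) • h101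
      - (1 / 8 : ℂ) • h011 - (Complex.I / 8) • h111
    clear hJ h000 h100 h010 h001 h110 h101 h011 h111
    match_scalars <;> grind
  · linear_combination (norm := skip) (1 / 8 : ℂ) • h000 - (Complex.I / 8) • h100
      - (Complex.I / 8) • h010 + (Complex.I / 8) • h001 - (1 / 8 : ℂ) • h110 + (1 / 8 : ℂ) • h101
      + (1 / 8 : ℂ) • h011 - (Complex.I / 8) • h111
    clear hJ h000 h100 h010 h001 h110 h101 h011 h111
    match_scalars <;> grind

end Splitting

end NilComplex

/-! ### From (g, J) to the complex data -/

noncomputable section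

namespace NilComplex

open Module

variable {g : Type*} [LieRing g] [LieAlgebra ℝ g]

/-- The bracket of `(1,0)`-vectors, transported to `g`. -/
def holBracket (J : g →ₗ[ℝ] g) (x y : g) : g := (1 / 2 : ℝ) • (⁅x, y⁆ - ⁅J x, J y⁆)

/-- The `(1,0)`-part of the bracket of a `(0,1)`-vector with a `(1,0)`-vector, transported
to `g`. -/
def mixBracket (J : g →ₗ[ℝ] g) (x y : g) : g := (1 / 2 : ℝ) • (⁅x, y⁆ + J ⁅J x, y⁆)

section

variable {J : g →ₗ[ℝ] g}

lemma IsComplexStructure.lie_J (hJ : IsComplexStructure J) (x y : g) :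
    ⁅J x, J y⁆ = ⁅x, y⁆ + J ⁅J x, y⁆ + J ⁅x, J y⁆ :=
  (sub_eq_zero.1 (hJ.nijenhuis x y)).symm

/-- The vanishing of the Nijenhuis tensor leaves no further component in the bracket. -/
lemma lie_eq_holBracket (hJ : IsComplexStructure J) (x y : g) :
    ⁅x, y⁆ = holBracket J x y + mixBracket J x y - mixBracket J y x := by
  have h := hJ.lie_J x y
  simp only [holBracket, mixBracket, ← lie_skew y x, ← lie_skew (J y) x, map_neg]
  linear_combination (norm := module) (1 / 2 : ℝ) • h

lemma holBracket_J_left (hJ : IsComplexStructure J) (x y : g) :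
    holBracket J (J x) y = J (holBracket J x y) := by
  simp only [holBracket, hJ.sq, hJ.lie_J x y, map_smul, map_sub, map_add, neg_lie]
  module

lemma holBracket_J_right (hJ : IsComplexStructure J) (x y : g) :
    holBracket J x (J y) = J (holBracket J x y) := by
  simp only [holBracket, hJ.sq, hJ.lie_J x y, map_smul, map_sub, map_add, lie_neg]
  module

lemma mixBracket_J_left (hJ : IsComplexStructure J) (x y : g) :
    mixBracket J (J x) y = -J (mixBracket J x y) := by
  simp only [mixBracket, hJ.sq, map_smul, map_add, neg_lie, map_neg]
  module

lemma mixBracket_J_right (hJ : IsComplexStructure J) (x y : g) :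
    mixBracket J x (J y) = J (mixBracket J x y) := by
  simp only [mixBracket, hJ.sq, hJ.lie_J x y, map_smul, map_add]
  module

end

/-- The real vector space `g` regarded as a complex vector space through `J`. -/
def CSpace (J : g →ₗ[ℝ] g) (_ : IsComplexStructure J) : Type _ := g

variable {J : g →ₗ[ℝ] g} {hJ : IsComplexStructure J}

instance : AddCommGroup (CSpace J hJ) := inferInstanceAs (AddCommGroup g)

variable (hJ) in
/-- The identity map from `g` to the complex space. -/
def toC : g ≃+ CSpace J hJ := AddEquiv.refl g

/-- Multiplication by complex numbers, with `J` as multiplication by `i`. -/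
def cSmul (J : g →ₗ[ℝ] g) (c : ℂ) (x : g) : g := c.re • x + c.im • J x

lemma one_cSmul (x : g) : cSmul J 1 x = x := by simp [cSmul]

lemma mul_cSmul (hJ : IsComplexStructure J) (a c : ℂ) (x : g) :
    cSmul J (a * c) x = cSmul J a (cSmul J c x) := by
  simp only [cSmul, Complex.mul_re, Complex.mul_im, map_add, map_smul, hJ.sq]
  module

lemma cSmul_zero (a : ℂ) : cSmul J a 0 = 0 := by simp [cSmul]

lemma cSmul_add (a : ℂ) (x y : g) : cSmul J a (x + y) = cSmul J a x + cSmul J a y := by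
  simp only [cSmul, map_add]
  module

lemma add_cSmul (a c : ℂ) (x : g) : cSmul J (a + c) x = cSmul J a x + cSmul J c x := by
  simp only [cSmul, Complex.add_re, Complex.add_im]
  module

lemma zero_cSmul (x : g) : cSmul J 0 x = 0 := by simp [cSmul]

instance : Module ℂ (CSpace J hJ) where
  smul c x := toC hJ (cSmul J c ((toC hJ).symm x))
  one_smul := one_cSmul (J := J)
  mul_smul := mul_cSmul (g := g) hJ
  smul_zero := cSmul_zero (J := J)
  smul_add := cSmul_add (J := J)
  add_smul := add_cSmul (J := J)
  zero_smul := zero_cSmul (J := J)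

lemma toC_smul (r : ℝ) (x : g) : toC hJ (r • x) = (r : ℂ) • toC hJ x := by
  change r • x = Complex.re r • x + Complex.im r • J x
  simp

lemma toC_J (x : g) : toC hJ (J x) = Complex.I • toC hJ x := by
  change J x = Complex.re Complex.I • x + Complex.im Complex.I • J x
  simp

lemma smul_toC (c : ℂ) (x : g) : c • toC hJ x = toC hJ (c.re • x + c.im • J x) := rfl

variable (hJ) in
/-- `holBracket` as a complex bilinear map. -/
def holMap : CSpace J hJ →ₗ[ℂ] CSpace J hJ →ₗ[ℂ] CSpace J hJ :=
  LinearMap.mk₂ ℂ (fun x y => toC hJ (holBracket J ((toC hJ).symm x) ((toC hJ).symm y)))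
    (by
      intro x x' y
      rw [← map_add]
      refine congrArg (toC hJ) ?_
      simp only [holBracket, map_add, add_lie]
      module)
    (by
      intro c x y
      obtain ⟨x, rfl⟩ := (toC hJ).surjective x
      obtain ⟨y, rfl⟩ := (toC hJ).surjective y
      simp only [smul_toC, AddEquiv.symm_apply_apply]
      rw [← holBracket_J_left hJ]
      refine congrArg (toC hJ) ?_
      simp only [holBracket, map_add, map_smul, add_lie, smul_lie]
      module)
    (by
      intro x y y'
      rw [← map_add]
      refine congrArg (toC hJ) ?_
      simp only [holBracket, map_add, lie_add]
      module)
    (by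
      intro c x y
      obtain ⟨x, rfl⟩ := (toC hJ).surjective x
      obtain ⟨y, rfl⟩ := (toC hJ).surjective y
      simp only [smul_toC, AddEquiv.symm_apply_apply]
      rw [← holBracket_J_right hJ]
      refine congrArg (toC hJ) ?_
      simp only [holBracket, map_add, map_smul, lie_add, lie_smul]
      module)

variable (hJ) in
/-- `mixBracket` as a complex sesquilinear map. -/
def mixMap : CSpace J hJ →ₛₗ[starRingEnd ℂ] CSpace J hJ →ₗ[ℂ] CSpace J hJ :=
  LinearMap.mk₂'ₛₗ (starRingEnd ℂ) (RingHom.id ℂ)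
    (fun x y => toC hJ (mixBracket J ((toC hJ).symm x) ((toC hJ).symm y)))
    (by
      intro x x' y
      rw [← map_add]
      refine congrArg (toC hJ) ?_
      simp only [mixBracket, map_add, add_lie]
      module)
    (by
      intro c x y
      obtain ⟨x, rfl⟩ := (toC hJ).surjective x
      obtain ⟨y, rfl⟩ := (toC hJ).surjective y
      simp only [smul_toC, AddEquiv.symm_apply_apply, Complex.conj_re, Complex.conj_im, neg_smul]
      rw [← smul_neg, ← mixBracket_J_left hJ]
      refine congrArg (toC hJ) ?_
      simp only [mixBracket, map_add, map_smul, add_lie, smul_lie]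
      module)
    (by
      intro x y y'
      rw [← map_add]
      refine congrArg (toC hJ) ?_
      simp only [mixBracket, map_add, lie_add]
      module)
    (by
      intro c x y
      obtain ⟨x, rfl⟩ := (toC hJ).surjective x
      obtain ⟨y, rfl⟩ := (toC hJ).surjective y
      simp only [smul_toC, AddEquiv.symm_apply_apply, RingHom.id_apply]
      rw [← mixBracket_J_right hJ]
      refine congrArg (toC hJ) ?_
      simp only [mixBracket, map_add, map_smul, lie_add, lie_smul]
      module)

lemma holMap_apply (x y : g) : holMap hJ (toC hJ x) (toC hJ y) = toC hJ (holBracket J x y) := rfl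

lemma mixMap_apply (x y : g) : mixMap hJ (toC hJ x) (toC hJ y) = toC hJ (mixBracket J x y) := rfl

lemma toC_lie (x y : g) : toC hJ ⁅x, y⁆ = holMap hJ (toC hJ x) (toC hJ y)
    + mixMap hJ (toC hJ x) (toC hJ y) - mixMap hJ (toC hJ y) (toC hJ x) := by
  rw [lie_eq_holBracket hJ, map_sub, map_add]; rfl

lemma splitting (x y v : CSpace J hJ) :
    holMap hJ x (holMap hJ y v) = holMap hJ (holMap hJ x y) v + holMap hJ y (holMap hJ x v) ∧
    mixMap hJ (holMap hJ x y) v = mixMap hJ x (mixMap hJ y v) - mixMap hJ y (mixMap hJ x v) ∧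
    mixMap hJ v (holMap hJ x y) = holMap hJ x (mixMap hJ v y) - holMap hJ y (mixMap hJ v x)
      - mixMap hJ (mixMap hJ x v) y + mixMap hJ (mixMap hJ y v) x := by
  refine splitting_eval (fun x y v => ?_) x y v
  obtain ⟨x, rfl⟩ := (toC hJ).surjective x
  obtain ⟨y, rfl⟩ := (toC hJ).surjective y
  obtain ⟨v, rfl⟩ := (toC hJ).surjective v
  simp only [← toC_lie]
  rw [← map_add, leibniz_lie]

lemma holMap_self (x : CSpace J hJ) : holMap hJ x x = 0 := by
  obtain ⟨x, rfl⟩ := (toC hJ).surjective x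
  rw [holMap_apply, holBracket, lie_self, lie_self, sub_zero, smul_zero, map_zero]

lemma holMap_skew (x y : CSpace J hJ) : holMap hJ x y = -holMap hJ y x := by
  obtain ⟨x, rfl⟩ := (toC hJ).surjective x
  obtain ⟨y, rfl⟩ := (toC hJ).surjective y
  rw [holMap_apply, holMap_apply, ← map_neg, holBracket, holBracket, ← lie_skew, ← lie_skew (J x)]
  congr 1; module

open LieModule in
lemma lie_mem_lowerCentralSeries {k : ℕ} {y : g} (x : g)
    (hy : y ∈ lowerCentralSeries ℝ g g k) : ⁅x, y⁆ ∈ lowerCentralSeries ℝ g g (k + 1) := by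
  rw [lowerCentralSeries_succ]
  exact LieSubmodule.lie_mem_lie (LieSubmodule.mem_top x) hy

variable (hJ) in
open LieModule in
/-- The complex subspaces `g^k ∩ J g^k`, where `g^k` is the lower central series. -/
def lowerInf (k : ℕ) : Submodule ℂ (CSpace J hJ) where
  carrier := {x | (toC hJ).symm x ∈ lowerCentralSeries ℝ g g k ∧
    J ((toC hJ).symm x) ∈ lowerCentralSeries ℝ g g k}
  add_mem' := by
    intro x y hx hy
    refine ⟨?_, ?_⟩
    · rw [map_add]; exact add_mem hx.1 hy.1
    · rw [map_add, map_add]; exact add_mem hx.2 hy.2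
  zero_mem' := by simp
  smul_mem' := by
    intro c x hx
    obtain ⟨x, rfl⟩ := (toC hJ).surjective x
    simp only [Set.mem_ofPred_eq, smul_toC, AddEquiv.symm_apply_apply, map_add, map_smul, hJ.sq,
      smul_neg] at hx ⊢
    exact ⟨add_mem (Submodule.smul_mem _ _ hx.1) (Submodule.smul_mem _ _ hx.2),
      add_mem (Submodule.smul_mem _ _ hx.2) (neg_mem (Submodule.smul_mem _ _ hx.1))⟩

variable (hJ) in
open LieModule in
/-- The complex subspaces `g^k + J g^k`, where `g^k` is the lower central series. -/
def lowerSup (k : ℕ) : Submodule ℂ (CSpace J hJ) where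
  carrier := {x | ∃ a ∈ lowerCentralSeries ℝ g g k, ∃ b ∈ lowerCentralSeries ℝ g g k,
    (toC hJ).symm x = a + J b}
  add_mem' := by
    rintro x y ⟨a, ha, b, hb, hx⟩ ⟨a', ha', b', hb', hy⟩
    exact ⟨a + a', add_mem ha ha', b + b', add_mem hb hb', by rw [map_add, hx, hy, map_add]; abel⟩
  zero_mem' := ⟨0, zero_mem _, 0, zero_mem _, by simp⟩
  smul_mem' := by
    rintro c x ⟨a, ha, b, hb, hx⟩
    obtain ⟨x, rfl⟩ := (toC hJ).surjective x
    rw [AddEquiv.symm_apply_apply] at hx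
    refine ⟨c.re • a - c.im • b, sub_mem (Submodule.smul_mem _ _ ha) (Submodule.smul_mem _ _ hb),
      c.re • b + c.im • a, add_mem (Submodule.smul_mem _ _ hb) (Submodule.smul_mem _ _ ha), ?_⟩
    rw [smul_toC, AddEquiv.symm_apply_apply, hx]
    simp only [map_add, map_smul, hJ.sq]
    module

/-- `holBracket J x w` contains both [x, w] and [Jx, Jw], so w and Jw must both lie in the lower
central term: the intersections `lowerInf` are the filtration that works. -/
lemma isNilpotent_holMap [LieRing.IsNilpotent g] (x : CSpace J hJ) : IsNilpotent (holMap hJ x) := by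
  refine Lowers.isNilpotent (Fil := lowerInf hJ) ?_ ?_ ?_
  · rw [eq_top_iff]
    intro y _
    change _ ∧ _
    simp
  · obtain ⟨n, hn⟩ := LieModule.IsNilpotent.nilpotent ℝ g g
    refine ⟨n, eq_bot_iff.2 fun y hy => ?_⟩
    have := hy.1
    rw [hn, LieSubmodule.mem_bot] at this
    simpa using this
  · intro k y hy
    obtain ⟨x, rfl⟩ := (toC hJ).surjective x
    obtain ⟨y, rfl⟩ := (toC hJ).surjective y
    obtain ⟨h1, h2⟩ := hy
    rw [AddEquiv.symm_apply_apply] at h1 h2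
    have key : ∀ w, w ∈ LieModule.lowerCentralSeries ℝ g g k →
        J w ∈ LieModule.lowerCentralSeries ℝ g g k →
        holBracket J x w ∈ LieModule.lowerCentralSeries ℝ g g (k + 1) := fun w h1 h2 =>
      Submodule.smul_mem _ _ (sub_mem (lie_mem_lowerCentralSeries x h1)
        (lie_mem_lowerCentralSeries (J x) h2))
    rw [holMap_apply]
    refine ⟨key y h1 h2, ?_⟩
    rw [AddEquiv.symm_apply_apply, ← holBracket_J_right hJ]
    refine key (J y) h2 ?_
    rw [hJ.sq]
    exact neg_mem h1

/-- `mixBracket J x w` is half of [x, w] + J[Jx, w], which for w in the k-th term lies in the next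
term plus its J-image. This is why the sums are used here. -/
lemma lowers_mixMap (x : CSpace J hJ) : Lowers (lowerSup hJ) (mixMap hJ x) := by
  rintro k y ⟨a, ha, b, hb, hy⟩
  obtain ⟨x, rfl⟩ := (toC hJ).surjective x
  have hy' : y = toC hJ (a + J b) := by rw [← hy, AddEquiv.apply_symm_apply]
  have key : ∀ w ∈ LieModule.lowerCentralSeries ℝ g g k,
      toC hJ (mixBracket J x w) ∈ lowerSup hJ (k + 1) := fun w hw =>
    ⟨(1 / 2 : ℝ) • ⁅x, w⁆, Submodule.smul_mem _ _ (lie_mem_lowerCentralSeries x hw),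
      (1 / 2 : ℝ) • ⁅J x, w⁆, Submodule.smul_mem _ _ (lie_mem_lowerCentralSeries (J x) hw), by
        rw [AddEquiv.symm_apply_apply, mixBracket, smul_add, map_smul]⟩
  rw [hy', map_add, map_add, toC_J, map_smul]
  exact add_mem (key a ha) (Submodule.smul_mem _ _ (key b hb))

theorem matchedBracket [LieRing.IsNilpotent g] (hS : IsSnN J) :
    MatchedBracket (holMap hJ) (mixMap hJ) where
  alt := holMap_self
  jac x y v := (splitting x y v).1
  rep x y v := (splitting x y v).2.1
  mix x x' y := by rw [(splitting x x' y).2.2, holMap_skew x' (mixMap hJ y x)]; abel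
  nilμ := isNilpotent_holMap
  nilρ := by
    refine ⟨lowerSup hJ, ?_, ?_, ?_, lowers_mixMap⟩
    · rintro k l hkl x ⟨a, ha, b, hb, hx⟩
      have := LieModule.antitone_lowerCentralSeries ℝ g g hkl
      exact ⟨a, this ha, b, this hb, hx⟩
    · rw [eq_top_iff]
      intro y _
      exact ⟨(toC hJ).symm y, by simp, 0, by simp, by simp⟩
    · obtain ⟨n, hn⟩ := LieModule.IsNilpotent.nilpotent ℝ g g
      refine ⟨n, eq_bot_iff.2 fun y hy => ?_⟩
      obtain ⟨a, ha, b, hb, hy⟩ := hy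
      rw [hn, LieSubmodule.mem_bot] at ha hb
      subst ha hb
      simpa using hy
  snn x h1 h2 h3 := by
    obtain ⟨x, rfl⟩ := (toC hJ).surjective x
    have key : ∀ c : ℂ, ∀ y, holMap hJ (c • toC hJ x) (toC hJ y)
        + mixMap hJ (c • toC hJ x) (toC hJ y) - mixMap hJ (toC hJ y) (c • toC hJ x) = 0 := by
      intro c y
      simp [h1, h2, h3]
    have : x ∈ compatibleSeries J 1 := by
      intro y
      constructor
      · have := key 1 y
        rw [one_smul, ← toC_lie] at this
        exact (Submodule.mem_bot ℝ).2 ((toC hJ).map_eq_zero_iff.1 this)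
      · have := key Complex.I y
        rw [← toC_J, ← toC_lie] at this
        exact (Submodule.mem_bot ℝ).2 ((toC hJ).map_eq_zero_iff.1 this)
    rw [hS, Submodule.mem_bot] at this
    rw [this, map_zero]

lemma isDistinguished {z : g} (hz : z ≠ 0) (hc : ∀ y : g, ⁅z, y⁆ = 0) :
    IsDistinguished (holMap hJ) (mixMap hJ) (toC hJ (J z)) where
  ne_zero := by
    rw [Ne, (toC hJ).map_eq_zero_iff]
    intro h
    have := hJ.sq z
    rw [h, map_zero] at this
    exact hz (neg_eq_zero.1 this.symm)
  right y := by
    obtain ⟨y, rfl⟩ := (toC hJ).surjective y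
    rw [toC_J, map_smul, mixMap_apply, mixBracket, ← lie_skew y z, ← lie_skew (J y) z, hc, hc]
    simp
  left := by
    refine LinearMap.ext fun y => ?_
    obtain ⟨y, rfl⟩ := (toC hJ).surjective y
    rw [mixMap_apply, holMap_apply, mixBracket, holBracket, hJ.sq, neg_lie, neg_lie, hc, hc]
    simp

lemma exists_central [Nontrivial g] [LieRing.IsNilpotent g] :
    ∃ z : g, z ≠ 0 ∧ ∀ y : g, ⁅z, y⁆ = 0 := by
  have := LieModule.nontrivial_max_triv_of_isNilpotent ℝ g g
  obtain ⟨z, hz⟩ := exists_ne (0 : LieModule.maxTrivSubmodule ℝ g g)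
  refine ⟨z, by simpa using hz, fun y => ?_⟩
  have := (LieModule.mem_maxTrivSubmodule ℝ g g (z : g)).1 z.2 y
  rw [← lie_skew, this, neg_zero]

lemma finrank_cSpace (hdim : finrank ℝ g = 8) : finrank ℂ (CSpace J hJ) = 4 := by
  let e : g ≃ₗ[ℝ] CSpace J hJ :=
    { toC hJ with
      map_smul' := fun r x => toC_smul r x }
  have h1 := e.finrank_eq
  have h2 := finrank_real_of_complex (CSpace J hJ)
  omega

end NilComplex

end

/-! ### Adapted complex coordinates on g -/

noncomputable section

namespace NilComplex

open Module

/-- Because ρ ζ = μ ζ and ρ(·, ζ) = 0, the last coordinate enters only as x₃ + conj x₃. -/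
lemma NormalForm.bracket {E : Type*} [AddCommGroup E] [Module ℂ E]
    {μ : E →ₗ[ℂ] E →ₗ[ℂ] E} {ρ : E →ₛₗ[starRingEnd ℂ] E →ₗ[ℂ] E} {b : Basis (Fin 4) ℂ E}
    {β ε η κ A F p q L m n : ℂ} {s : ℝ} (h : MatchedBracket μ ρ)
    (hb : NormalForm μ ρ b β ε η κ A F p q L m n s) {x₀ x₁ x₂ x₃ y₀ y₁ y₂ y₃ : ℂ} {X Y : E}
    (hX : X = x₀ • b 0 + x₁ • b 1 + x₂ • b 2 + x₃ • b 3)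
    (hY : Y = y₀ • b 0 + y₁ • b 1 + y₂ • b 2 + y₃ • b 3) :
    μ X Y + ρ X Y - ρ Y X =
      (A * (cc x₀ * y₀ - cc y₀ * x₀) + β * ((x₃ + cc x₃) * y₀ - (y₃ + cc y₃) * x₀)) • b 1 +
      (κ * (x₀ * y₁ - x₁ * y₀) + ε * ((x₃ + cc x₃) * y₀ - (y₃ + cc y₃) * x₀) +
        η * ((x₃ + cc x₃) * y₁ - (y₃ + cc y₃) * x₁) + F * (cc x₀ * y₀ - cc y₀ * x₀) +
        p * (cc x₀ * y₁ - cc y₀ * x₁) + q * (cc x₁ * y₀ - cc y₁ * x₀)) • b 2 +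
      (L * (cc x₀ * y₀ - cc y₀ * x₀) + cc m * (cc x₀ * y₁ - cc y₀ * x₁) +
        m * (cc x₁ * y₀ - cc y₁ * x₀) + cc n * (cc x₀ * y₂ - cc y₀ * x₂) +
        n * (cc x₂ * y₀ - cc y₂ * x₀) + s * (cc x₁ * y₁ - cc y₁ * x₁)) • b 3 := by
  have m00 : μ (b 0) (b 0) = 0 := h.alt _
  have m11 : μ (b 1) (b 1) = 0 := h.alt _
  have m22 : μ (b 2) (b 2) = 0 := h.alt _
  have m33 : μ (b 3) (b 3) = 0 := h.alt _
  have m10 : μ (b 1) (b 0) = -(κ • b 2) := by rw [h.skew, hb.μ01]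
  have m20 : μ (b 2) (b 0) = 0 := by rw [h.skew, hb.μ02, neg_zero]
  have m21 : μ (b 2) (b 1) = 0 := by rw [h.skew, hb.μ12, neg_zero]
  have m03 : μ (b 0) (b 3) = -(β • b 1 + ε • b 2) := by rw [h.skew, hb.μ30]
  have m13 : μ (b 1) (b 3) = -(η • b 2) := by rw [h.skew, hb.μ31]
  have m23 : μ (b 2) (b 3) = 0 := by rw [h.skew, hb.μ32, neg_zero]
  subst hX hY
  simp only [map_add, map_smul, map_smulₛₗ, LinearMap.add_apply, LinearMap.smul_apply,
    hb.dist.right, hb.dist.left, m00, m11, m22, m33, m10, m20, m21, m03, m13, m23, hb.μ01, hb.μ02,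
    hb.μ12, hb.μ30, hb.μ31, hb.μ32, hb.ρ00, hb.ρ01, hb.ρ02, hb.ρ10, hb.ρ11, hb.ρ12, hb.ρ20, hb.ρ21,
    hb.ρ22, cc]
  module

variable {g : Type*} [LieRing g] [LieAlgebra ℝ g]

/-- Complex coordinates on `(g, J)` in which the Lie bracket has the common normal form. -/
structure Coordinates (J : g →ₗ[ℝ] g) (f : Fin 4 → g →ₗ[ℝ] ℂ)
    (A B E F H κ p q L M N : ℂ) (s : ℝ) : Prop where
  map_J : ∀ i x, f i (J x) = Complex.I * f i x
  ext : ∀ x, f 0 x = 0 → f 1 x = 0 → f 2 x = 0 → f 3 x = 0 → x = 0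
  surj : ∀ c₀ c₁ c₂ c₃ : ℂ, ∃ x, f 0 x = c₀ ∧ f 1 x = c₁ ∧ f 2 x = c₂ ∧ f 3 x = c₃
  lie₀ : ∀ x y : g, f 0 ⁅x, y⁆ = 0
  lie₁ : ∀ x y : g, f 1 ⁅x, y⁆ = A * (cc (f 0 x) * f 0 y - cc (f 0 y) * f 0 x)
    - B * ((f 3 x - cc (f 3 x)) * f 0 y - (f 3 y - cc (f 3 y)) * f 0 x)
  lie₂ : ∀ x y : g, f 2 ⁅x, y⁆ = κ * (f 0 x * f 1 y - f 1 x * f 0 y)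
    - E * ((f 3 x - cc (f 3 x)) * f 0 y - (f 3 y - cc (f 3 y)) * f 0 x)
    - H * ((f 3 x - cc (f 3 x)) * f 1 y - (f 3 y - cc (f 3 y)) * f 1 x)
    + F * (cc (f 0 x) * f 0 y - cc (f 0 y) * f 0 x)
    + p * (cc (f 0 x) * f 1 y - cc (f 0 y) * f 1 x)
    + q * (cc (f 1 x) * f 0 y - cc (f 1 y) * f 0 x)
  lie₃ : ∀ x y : g, f 3 ⁅x, y⁆ = L * (cc (f 0 x) * f 0 y - cc (f 0 y) * f 0 x)
    - cc M * (cc (f 0 x) * f 1 y - cc (f 0 y) * f 1 x)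
    + M * (cc (f 1 x) * f 0 y - cc (f 1 y) * f 0 x)
    - cc N * (cc (f 0 x) * f 2 y - cc (f 0 y) * f 2 x)
    + N * (cc (f 2 x) * f 0 y - cc (f 2 y) * f 0 x)
    + Complex.I * s * (cc (f 1 x) * f 1 y - cc (f 1 y) * f 1 x)

/-- A complex multiple of a coordinate function on `CSpace`, as a real-linear form on `g`. -/
def coordForm {J : g →ₗ[ℝ] g} {hJ : IsComplexStructure J} (b : Basis (Fin 4) ℂ (CSpace J hJ))
    (c : ℂ) (i : Fin 4) : g →ₗ[ℝ] ℂ where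
  toFun x := c * b.repr (toC hJ x) i
  map_add' x y := by simp [mul_add]
  map_smul' r x := by
    rw [toC_smul]
    simp only [map_smul, Finsupp.smul_apply, smul_eq_mul, RingHom.id_apply, Complex.real_smul]
    ring

lemma coordForm_apply {J : g →ₗ[ℝ] g} {hJ : IsComplexStructure J}
    (b : Basis (Fin 4) ℂ (CSpace J hJ)) (c : ℂ) (i : Fin 4) (x : g) :
    coordForm b c i x = c * b.repr (toC hJ x) i := rfl

theorem exists_coordinates [LieRing.IsNilpotent g] (hdim : finrank ℝ g = 8) {J : g →ₗ[ℝ] g}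
    (hJ : IsComplexStructure J) (hS : IsSnN J) :
    ∃ (f : Fin 4 → g →ₗ[ℝ] ℂ) (A B E F H κ p q L M N : ℂ) (s : ℝ),
      Coordinates J f A B E F H κ p q L M N s ∧ N ≠ 0 ∧
      ((B ≠ 0 ∧ E = 0 ∧ H ≠ 0 ∧ L.re = 0) ∨
       (B ≠ 0 ∧ E = 0 ∧ H = 0 ∧ p ≠ 0 ∧ s = 0) ∨
       (B = 0 ∧ E ≠ 0 ∧ H = 0 ∧ p ≠ 0) ∨
       (B = 0 ∧ E = Complex.I ∧ H = 0 ∧ κ = 1 / 2 ∧ q = 1 / 2 ∧ p = 0 ∧ s ≠ 0) ∨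
       (B = 0 ∧ E ≠ 0 ∧ H = 0 ∧ κ = 0 ∧ q = 0 ∧ p = 0 ∧ s ≠ 0)) := by
  have : Nontrivial g := Module.nontrivial_of_finrank_pos (R := ℝ) (by omega)
  obtain ⟨z, hz, hc⟩ := exists_central (g := g)
  have hmb := matchedBracket (hJ := hJ) hS
  obtain ⟨b, β, ε, η, κ, A, F, p, q, L, m, n, s, hb3, hnf, hn, hcases⟩ :=
    hmb.exists_normalForm (finrank_cSpace hdim) (isDistinguished hz hc)
  have hI := Complex.I_sq
  have hexp : ∀ x : g, toC hJ x = b.repr (toC hJ x) 0 • b 0 + b.repr (toC hJ x) 1 • b 1 +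
      b.repr (toC hJ x) 2 • b 2 + b.repr (toC hJ x) 3 • b 3 := fun x => by
    have := (b.sum_repr (toC hJ x)).symm
    rwa [Fin.sum_univ_four] at this
  have hrep : ∀ i (a₀ a₁ a₂ a₃ : ℂ), b.repr (a₀ • b 0 + a₁ • b 1 + a₂ • b 2 + a₃ • b 3) i =
      ![a₀, a₁, a₂, a₃] i := fun i a₀ a₁ a₂ a₃ => by
    fin_cases i <;> simp
  have hlie : ∀ x y : g, _ := fun x y => (toC_lie (hJ := hJ) x y).trans
    (hnf.bracket hmb (hexp x) (hexp y))
  have hrep' : ∀ i (a₁ a₂ a₃ : ℂ), b.repr (a₁ • b 1 + a₂ • b 2 + a₃ • b 3) i =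
      ![0, a₁, a₂, a₃] i := fun i a₁ a₂ a₃ => by
    fin_cases i <;> simp
  -- The factor i on the last coordinate gives f₃(z) = 1 for the central z with ζ = Jz and turns x₃
  -- + conj x₃ into −i(f₃ − conj f₃). This accounts for the factors i in the constants.
  refine ⟨![coordForm b 1 0, coordForm b 1 1, coordForm b 1 2, coordForm b Complex.I 3], A,
    Complex.I * β, Complex.I * ε, F, Complex.I * η, κ, p, q, Complex.I * L, Complex.I * m,
    Complex.I * n, s, ?_, mul_ne_zero Complex.I_ne_zero hn, ?_⟩
  · constructor
    · intro i x
      fin_cases i <;> simp [coordForm_apply, toC_J]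
    · intro x h0 h1 h2 h3
      simp [coordForm_apply] at h0 h1 h2 h3
      have := hexp x
      rw [h0, h1, h2, h3] at this
      simpa using this
    · intro c₀ c₁ c₂ c₃
      refine ⟨(toC hJ).symm (c₀ • b 0 + c₁ • b 1 + c₂ • b 2 + (-Complex.I * c₃) • b 3), ?_⟩
      simp only [Matrix.cons_val, coordForm_apply, AddEquiv.apply_symm_apply, hrep]
      refine ⟨by ring, by ring, by ring, ?_⟩
      linear_combination -c₃ * hI
    · intro x y
      simp only [Matrix.cons_val, coordForm_apply, hlie, hrep']
      ring
    · intro x y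
      simp only [Matrix.cons_val, coordForm_apply, hlie, hrep', cc, map_mul, Complex.conj_I,
        map_one]
      grind
    · intro x y
      simp only [Matrix.cons_val, coordForm_apply, hlie, hrep', cc, map_mul, Complex.conj_I,
        map_one]
      grind
    · intro x y
      simp only [Matrix.cons_val, coordForm_apply, hlie, hrep', cc, map_mul, Complex.conj_I,
        map_one]
      ring
  · rcases hcases with ⟨rfl, rfl, rfl, -, hL⟩ | ⟨rfl, rfl, rfl, hp, hs⟩ |
      ⟨rfl, rfl, rfl, rfl, hp⟩ | ⟨rfl, rfl, rfl, rfl, rfl, rfl, hs⟩ |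
      ⟨rfl, rfl, rfl, rfl, rfl, rfl, hs⟩
    · exact Or.inl (by simp [hL])
    · exact Or.inr (Or.inl (by simp [hp, hs]))
    · exact Or.inr (Or.inr (Or.inl (by simp [hp])))
    · exact Or.inr (Or.inr (Or.inr (Or.inl (by simp [hs]))))
    · exact Or.inr (Or.inr (Or.inr (Or.inr (by simp [hs]))))

end NilComplex

end

/-! ### Ascending central series and ascending type -/

noncomputable section

namespace NilComplex

open Module

section Ascending

variable {g : Type*} [LieRing g] [LieAlgebra ℝ g]

lemma mem_ascending_succ {k : ℕ} {x : g} :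
    x ∈ ascending g (k + 1) ↔ ∀ y : g, ⁅x, y⁆ ∈ ascending g k := by
  rw [ascending, LieSubmodule.ucs_succ, LieSubmodule.mem_normalizer]
  refine forall_congr' fun y => ?_
  rw [← lie_skew, neg_mem_iff]

lemma mem_ascending_one {x : g} : x ∈ ascending g 1 ↔ ∀ y : g, ⁅x, y⁆ = 0 := by
  simp only [← LieSubmodule.mem_bot (R := ℝ) (L := g) (M := g)]
  exact mem_ascending_succ (k := 0)

lemma ascending_succ_eq_top {k : ℕ} (h : ascending g k = ⊤) : ascending g (k + 1) = ⊤ := by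
  rw [eq_top_iff]
  intro x _
  rw [mem_ascending_succ, h]
  exact fun y => LieSubmodule.mem_top _

lemma ascending_eq_top_of_le {k l : ℕ} (hkl : k ≤ l) (h : ascending g k = ⊤) :
    ascending g l = ⊤ :=
  Nat.le_induction h (fun _ _ ih => ascending_succ_eq_top ih) l hkl

lemma finrank_eq_of_eq_top {S : LieSubmodule ℝ g g} (h : S = ⊤) :
    finrank ℝ S = finrank ℝ g := by
  subst h
  exact finrank_top ℝ g

/-- Once one type is established, the clauses about the other types in the final statement become
vacuous. -/
lemma HasAscendingType.unique {m m' : List ℕ} (h : HasAscendingType g m)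
    (h' : HasAscendingType g m') : m = m' :=
  List.ext_getElem (h.1.unique h'.1) fun k hk hk' => (h.2 k hk).symm.trans (h'.2 k hk')

lemma isLeast_step {n : ℕ} (hn : ascending g (n + 1) = ⊤)
    (hn' : finrank ℝ (ascending g n) ≠ finrank ℝ g) :
    IsLeast {s : ℕ | 1 ≤ s ∧ ∀ k, s ≤ k → ascending g k = ⊤} (n + 1) := by
  refine ⟨⟨by omega, fun k hk => ascending_eq_top_of_le hk hn⟩, fun s hs => ?_⟩
  by_contra! hlt
  exact hn' (finrank_eq_of_eq_top (hs.2 n (by omega)))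

lemma hasAscendingType_three (hdim : finrank ℝ g = 8) {a b : ℕ}
    (h1 : finrank ℝ (ascending g 1) = a) (h2 : finrank ℝ (ascending g 2) = b)
    (h3 : ascending g 3 = ⊤) (hb : b ≠ 8) : HasAscendingType g [a, b, 8] := by
  refine ⟨isLeast_step h3 ((h2.trans_ne hb).trans_eq hdim.symm), fun k hk => ?_⟩
  have := (finrank_eq_of_eq_top h3).trans hdim
  rcases k with _ | _ | _ | k
  · exact h1
  · exact h2
  · exact this
  · simp only [List.length_cons, List.length_nil] at hk
    omega

lemma hasAscendingType_four (hdim : finrank ℝ g = 8) {a b c : ℕ}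
    (h1 : finrank ℝ (ascending g 1) = a) (h2 : finrank ℝ (ascending g 2) = b)
    (h3 : finrank ℝ (ascending g 3) = c) (h4 : ascending g 4 = ⊤) (hc : c ≠ 8) :
    HasAscendingType g [a, b, c, 8] := by
  refine ⟨isLeast_step h4 ((h3.trans_ne hc).trans_eq hdim.symm), fun k hk => ?_⟩
  have := (finrank_eq_of_eq_top h4).trans hdim
  rcases k with _ | _ | _ | _ | k
  · exact h1
  · exact h2
  · exact h3
  · exact this
  · simp only [List.length_cons, List.length_nil] at hk
    omega

lemma hasAscendingType_five (hdim : finrank ℝ g = 8) {a b c d : ℕ}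
    (h1 : finrank ℝ (ascending g 1) = a) (h2 : finrank ℝ (ascending g 2) = b)
    (h3 : finrank ℝ (ascending g 3) = c) (h4 : finrank ℝ (ascending g 4) = d)
    (h5 : ascending g 5 = ⊤) (hd : d ≠ 8) : HasAscendingType g [a, b, c, d, 8] := by
  refine ⟨isLeast_step h5 ((h4.trans_ne hd).trans_eq hdim.symm), fun k hk => ?_⟩
  have := (finrank_eq_of_eq_top h5).trans hdim
  rcases k with _ | _ | _ | _ | _ | k
  · exact h1
  · exact h2
  · exact h3
  · exact h4
  · exact this
  · simp only [List.length_cons, List.length_nil] at hk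
    omega

lemma finrank_add_eq {r : ℕ} (hdim : finrank ℝ g = 8) (Φ : Fin r → g →ₗ[ℝ] ℝ)
    (hΦ : ∀ v : Fin r → ℝ, ∃ x, ∀ i, Φ i x = v i) {S : LieSubmodule ℝ g g}
    (hS : ∀ x, x ∈ S ↔ ∀ i, Φ i x = 0) : finrank ℝ S + r = 8 := by
  have : FiniteDimensional ℝ g := Module.finite_of_finrank_pos (by omega)
  have h1 := (LinearMap.pi Φ).finrank_range_add_finrank_ker
  have h2 : LinearMap.range (LinearMap.pi Φ) = ⊤ :=
    LinearMap.range_eq_top.2 fun v => (hΦ v).imp fun x hx => funext hx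
  have h3 : LinearMap.ker (LinearMap.pi Φ) = S.toSubmodule := by
    ext x
    rw [LinearMap.mem_ker, LieSubmodule.mem_toSubmodule, hS, funext_iff]
    rfl
  rw [h2, h3, finrank_top, finrank_fin_fun, hdim] at h1
  rw [add_comm]
  exact h1

end Ascending

lemma eq_zero_of_mul_eq_mul_conj {a b : ℂ} (h : ∀ z : ℂ, a * z + b * cc z = 0) :
    a = 0 ∧ b = 0 := by
  have h1 := h 1
  have h2 := h Complex.I
  rw [cc, map_one] at h1
  rw [cc, Complex.conj_I] at h2
  have hI := Complex.I_mul_I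
  constructor
  · linear_combination (1 / 2 : ℂ) * h1 - (1 / 2 : ℂ) * Complex.I * h2 - (b - a) / 2 * hI
  · linear_combination (1 / 2 : ℂ) * h1 + (1 / 2 : ℂ) * Complex.I * h2 - (a - b) / 2 * hI

lemma cc_zero : cc 0 = 0 := map_zero _

lemma cc_I : cc Complex.I = -Complex.I := Complex.conj_I

lemma sub_conj_eq_zero {z : ℂ} : z - cc z = 0 ↔ z.im = 0 := by
  rw [sub_eq_zero, eq_comm, Complex.conj_eq_iff_im]

lemma eq_zero_of_im_conj_mul {a : ℂ} (h : ∀ z : ℂ, (cc a * z).im = 0) : a = 0 := by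
  have h1 := h 1
  have h2 := h Complex.I
  simp [Complex.mul_im] at h1 h2
  exact Complex.ext h2 h1

lemma im_mul_conj_sub (c a z : ℂ) :
    (c * (cc a * z - cc z * a)).im = 2 * c.re * (cc a * z).im := by
  simp [Complex.mul_im, Complex.mul_re]
  ring

namespace Coordinates

variable {g : Type*} [LieRing g] [LieAlgebra ℝ g] {J : g →ₗ[ℝ] g} {f : Fin 4 → g →ₗ[ℝ] ℂ}
  {A B E F H κ p q L M N : ℂ} {s : ℝ}

/-! ### Dimensions from independent real equations -/

section Finrank

variable {S : LieSubmodule ℝ g g}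

lemma finrank_eq_one (hdim : finrank ℝ g = 8) (h : Coordinates J f A B E F H κ p q L M N s)
    (hS : ∀ x, x ∈ S ↔ f 0 x = 0 ∧ f 1 x = 0 ∧ f 2 x = 0 ∧ (f 3 x).im = 0) :
    finrank ℝ S = 1 := by
  have := finrank_add_eq hdim (S := S) ![Complex.reLm ∘ₗ f 0, Complex.imLm ∘ₗ f 0,
    Complex.reLm ∘ₗ f 1, Complex.imLm ∘ₗ f 1, Complex.reLm ∘ₗ f 2, Complex.imLm ∘ₗ f 2,
    Complex.imLm ∘ₗ f 3] (fun v => ?_) (fun x => ?_)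
  · omega
  · obtain ⟨x, h0, h1, h2, h3⟩ := h.surj ⟨v 0, v 1⟩ ⟨v 2, v 3⟩ ⟨v 4, v 5⟩ ⟨0, v 6⟩
    refine ⟨x, fun i => ?_⟩
    fin_cases i <;> simp [h0, h1, h2, h3]
  · rw [hS]
    simp [Fin.forall_fin_succ, Complex.ext_iff, and_assoc]

lemma finrank_eq_three (hdim : finrank ℝ g = 8) (h : Coordinates J f A B E F H κ p q L M N s)
    (hS : ∀ x, x ∈ S ↔ f 0 x = 0 ∧ f 1 x = 0 ∧ (f 3 x).im = 0) : finrank ℝ S = 3 := by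
  have := finrank_add_eq hdim (S := S) ![Complex.reLm ∘ₗ f 0, Complex.imLm ∘ₗ f 0,
    Complex.reLm ∘ₗ f 1, Complex.imLm ∘ₗ f 1, Complex.imLm ∘ₗ f 3] (fun v => ?_) (fun x => ?_)
  · omega
  · obtain ⟨x, h0, h1, h2, h3⟩ := h.surj ⟨v 0, v 1⟩ ⟨v 2, v 3⟩ 0 ⟨0, v 4⟩
    refine ⟨x, fun i => ?_⟩
    fin_cases i <;> simp [h0, h1, h3]
  · rw [hS]
    simp [Fin.forall_fin_succ, Complex.ext_iff, and_assoc]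

lemma finrank_eq_four (hdim : finrank ℝ g = 8) (h : Coordinates J f A B E F H κ p q L M N s)
    (hS : ∀ x, x ∈ S ↔ f 0 x = 0 ∧ (f 1 x).im = 0 ∧ (f 3 x).im = 0) : finrank ℝ S = 4 := by
  have := finrank_add_eq hdim (S := S) ![Complex.reLm ∘ₗ f 0, Complex.imLm ∘ₗ f 0,
    Complex.imLm ∘ₗ f 1, Complex.imLm ∘ₗ f 3] (fun v => ?_) (fun x => ?_)
  · omega
  · obtain ⟨x, h0, h1, h2, h3⟩ := h.surj ⟨v 0, v 1⟩ ⟨0, v 2⟩ 0 ⟨0, v 3⟩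
    refine ⟨x, fun i => ?_⟩
    fin_cases i <;> simp [h0, h1, h3]
  · rw [hS]
    simp [Fin.forall_fin_succ, Complex.ext_iff, and_assoc]

lemma finrank_eq_five (hdim : finrank ℝ g = 8) (h : Coordinates J f A B E F H κ p q L M N s)
    (hS : ∀ x, x ∈ S ↔ f 0 x = 0 ∧ (f 3 x).im = 0) : finrank ℝ S = 5 := by
  have := finrank_add_eq hdim (S := S) ![Complex.reLm ∘ₗ f 0, Complex.imLm ∘ₗ f 0,
    Complex.imLm ∘ₗ f 3] (fun v => ?_) (fun x => ?_)
  · omega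
  · obtain ⟨x, h0, h1, h2, h3⟩ := h.surj ⟨v 0, v 1⟩ 0 0 ⟨0, v 2⟩
    refine ⟨x, fun i => ?_⟩
    fin_cases i <;> simp [h0, h3]
  · rw [hS]
    simp [Fin.forall_fin_succ, Complex.ext_iff, and_assoc]

lemma finrank_eq_six (hdim : finrank ℝ g = 8) (h : Coordinates J f A B E F H κ p q L M N s)
    (hS : ∀ x, x ∈ S ↔ f 0 x = 0) : finrank ℝ S = 6 := by
  have := finrank_add_eq hdim (S := S) ![Complex.reLm ∘ₗ f 0, Complex.imLm ∘ₗ f 0]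
    (fun v => ?_) (fun x => ?_)
  · omega
  · obtain ⟨x, h0, h1, h2, h3⟩ := h.surj ⟨v 0, v 1⟩ 0 0 0
    refine ⟨x, fun i => ?_⟩
    fin_cases i <;> simp [h0]
  · rw [hS]
    simp [Fin.forall_fin_succ, Complex.ext_iff]

end Finrank

/-! ### The ascending series in coordinates -/

section Series

/-- The terms in M and N pair off with their conjugates and the term in s is i times a purely
imaginary number, so all of these are real; only Re L contributes. -/
lemma im_lie₃ (h : Coordinates J f A B E F H κ p q L M N s) (x y : g) :
    (f 3 ⁅x, y⁆).im = 2 * L.re * (cc (f 0 x) * f 0 y).im := by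
  rw [h.lie₃]
  simp [Complex.mul_im, Complex.mul_re]
  ring

lemma eq_zero_of_lie₁ (h : Coordinates J f A B E F H κ p q L M N s) (hB : B ≠ 0) {x : g}
    (hx : ∀ y : g, f 1 ⁅x, y⁆ = 0) : f 0 x = 0 ∧ (f 3 x).im = 0 := by
  obtain ⟨y, y0, -, -, y3⟩ := h.surj 0 0 0 Complex.I
  have h1 := hx y
  rw [h.lie₁, y0, y3] at h1
  have hx0 : f 0 x = 0 := by
    have : B * (2 * Complex.I) * f 0 x = 0 := by
      rw [← h1, cc_zero, cc_I]; ring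
    simpa [hB] using this
  obtain ⟨z, z0, -, -, z3⟩ := h.surj 1 0 0 0
  have h2 := hx z
  rw [h.lie₁, z0, z3, hx0] at h2
  refine ⟨hx0, sub_conj_eq_zero.1 ?_⟩
  simpa [hB] using h2

/-- A test vector with only f₃ = i isolates H. Vectors with only f₀ = c give a relation in c and
conj c whose two coefficients must vanish separately. -/
lemma eq_zero_of_lie₂ (h : Coordinates J f A B E F H κ p q L M N s) {x : g} (hx0 : f 0 x = 0)
    (hx : ∀ y : g, f 2 ⁅x, y⁆ = 0) : H * f 1 x = 0 ∧ p * f 1 x = 0 ∧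
      q * cc (f 1 x) - κ * f 1 x = E * (f 3 x - cc (f 3 x)) := by
  have h1 : H * f 1 x = 0 := by
    obtain ⟨y, y0, y1, -, y3⟩ := h.surj 0 0 0 Complex.I
    have h1 := hx y
    rw [h.lie₂, y0, y1, y3, hx0, cc_zero, cc_I] at h1
    have : 2 * Complex.I * (H * f 1 x) = 0 := by rw [← h1]; ring
    simpa using this
  have h2 := eq_zero_of_mul_eq_mul_conj (a := q * cc (f 1 x) - κ * f 1 x -
    E * (f 3 x - cc (f 3 x))) (b := -(p * f 1 x)) fun c => by
      obtain ⟨y, y0, y1, -, y3⟩ := h.surj c 0 0 0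
      rw [← hx y, h.lie₂, y0, y1, y3, hx0, cc_zero]
      ring
  exact ⟨h1, neg_eq_zero.1 h2.2, sub_eq_zero.1 h2.1⟩

lemma eq_zero_of_lie₂_left (h : Coordinates J f A B E F H κ p q L M N s) (hE : E ≠ 0)
    (hH : H = 0) {x : g} (hx : ∀ y : g, f 2 ⁅x, y⁆ = 0) : f 0 x = 0 := by
  obtain ⟨y, y0, y1, -, y3⟩ := h.surj 0 0 0 Complex.I
  have h1 := hx y
  rw [h.lie₂, y0, y1, y3, hH, cc_zero, cc_I] at h1
  have : E * (2 * Complex.I) * f 0 x = 0 := by rw [← h1]; ring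
  simpa [hE] using this

lemma eq_zero_of_lie₃ (h : Coordinates J f A B E F H κ p q L M N s) (hN : N ≠ 0) {x : g}
    (hx : ∀ y : g, f 3 ⁅x, y⁆ = 0) :
    f 0 x = 0 ∧ s * f 1 x = 0 ∧ (f 1 x = 0 → f 2 x = 0) := by
  have hx0 : f 0 x = 0 := by
    refine (mul_eq_zero.1 (neg_eq_zero.1 (eq_zero_of_mul_eq_mul_conj
      (a := -(cc N * cc (f 0 x))) (b := -(N * f 0 x)) fun c => ?_).2)).resolve_left hN
    obtain ⟨y, y0, y1, y2, -⟩ := h.surj 0 0 c 0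
    rw [← hx y, h.lie₃, y0, y1, y2, cc_zero]
    ring
  refine ⟨hx0, ?_, fun hx1 => ?_⟩
  · have := (eq_zero_of_mul_eq_mul_conj (a := Complex.I * s * cc (f 1 x))
      (b := -(Complex.I * s * f 1 x)) fun c => ?_).2
    · simpa using this
    · obtain ⟨y, y0, y1, y2, -⟩ := h.surj 0 c 0 0
      rw [← hx y, h.lie₃, y0, y1, y2, hx0, cc_zero]
      ring
  · have := (eq_zero_of_mul_eq_mul_conj (a := N * cc (f 2 x)) (b := cc N * f 2 x) fun c => ?_).2
    · simpa [hN] using this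
    · obtain ⟨y, y0, y1, y2, -⟩ := h.surj c 0 0 0
      rw [← hx y, h.lie₃, y0, y1, y2, hx0, hx1, cc_zero]
      ring

lemma lie_eq_zero (h : Coordinates J f A B E F H κ p q L M N s) {x : g} (hx0 : f 0 x = 0)
    (hx1 : f 1 x = 0) (hx3 : (f 3 x).im = 0) (y : g) : f 1 ⁅x, y⁆ = 0 ∧ f 2 ⁅x, y⁆ = 0 := by
  have := sub_conj_eq_zero.2 hx3
  rw [h.lie₁, h.lie₂, this, hx0, hx1, cc_zero]
  constructor <;> ring

lemma mem_ascending_one_iff (h : Coordinates J f A B E F H κ p q L M N s) (hN : N ≠ 0)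
    (hBE : B ≠ 0 ∨ E ≠ 0) (hs : H ≠ 0 ∨ p ≠ 0 ∨ s ≠ 0) (x : g) :
    x ∈ ascending g 1 ↔ f 0 x = 0 ∧ f 1 x = 0 ∧ f 2 x = 0 ∧ (f 3 x).im = 0 := by
  rw [mem_ascending_one]
  constructor
  · intro hx
    obtain ⟨hx0, hsx, hx2⟩ := h.eq_zero_of_lie₃ hN (x := x) fun y => by rw [hx, map_zero]
    obtain ⟨hHx, hpx, hEx⟩ := h.eq_zero_of_lie₂ hx0 fun y => by rw [hx, map_zero]
    have hx1 : f 1 x = 0 := by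
      rcases hs with hs | hs | hs
      · exact (mul_eq_zero.1 hHx).resolve_left hs
      · exact (mul_eq_zero.1 hpx).resolve_left hs
      · exact (mul_eq_zero.1 hsx).resolve_left (Complex.ofReal_ne_zero.2 hs)
    refine ⟨hx0, hx1, hx2 hx1, ?_⟩
    rcases hBE with hB | hE
    · exact (h.eq_zero_of_lie₁ hB fun y => by rw [hx, map_zero]).2
    · rw [hx1, cc_zero, mul_zero, mul_zero, sub_zero] at hEx
      exact sub_conj_eq_zero.1 ((mul_eq_zero.1 hEx.symm).resolve_left hE)
  · rintro ⟨hx0, hx1, hx2, hx3⟩ y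
    obtain ⟨h1, h2⟩ := h.lie_eq_zero hx0 hx1 hx3 y
    refine h.ext _ (h.lie₀ x y) h1 h2 ?_
    rw [h.lie₃, hx0, hx1, hx2, cc_zero]
    ring

lemma mem_ascending_two_iff (h : Coordinates J f A B E F H κ p q L M N s) (hN : N ≠ 0)
    (hBE : B ≠ 0 ∨ E ≠ 0) (hs : H ≠ 0 ∨ p ≠ 0 ∨ s ≠ 0) (x : g) :
    x ∈ ascending g 2 ↔ ∀ y : g, f 1 ⁅x, y⁆ = 0 ∧ f 2 ⁅x, y⁆ = 0 ∧ (f 3 ⁅x, y⁆).im = 0 := by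
  rw [mem_ascending_succ]
  refine forall_congr' fun y => ?_
  rw [h.mem_ascending_one_iff hN hBE hs]
  simp [h.lie₀]

lemma mem_ascending_two_iff_three (h : Coordinates J f A B E F H κ p q L M N s) (hN : N ≠ 0)
    (hBE : B ≠ 0 ∨ E ≠ 0 ∧ H = 0) (hs : H ≠ 0 ∨ p ≠ 0) (x : g) :
    x ∈ ascending g 2 ↔ f 0 x = 0 ∧ f 1 x = 0 ∧ (f 3 x).im = 0 := by
  rw [h.mem_ascending_two_iff hN (hBE.imp_right And.left)
    (hs.imp_right Or.inl)]
  constructor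
  · intro hx
    have hx0 : f 0 x = 0 := by
      rcases hBE with hB | ⟨hE, hH⟩
      · exact (h.eq_zero_of_lie₁ hB fun y => (hx y).1).1
      · exact h.eq_zero_of_lie₂_left hE hH fun y => (hx y).2.1
    obtain ⟨hHx, hpx, hEx⟩ := h.eq_zero_of_lie₂ hx0 fun y => (hx y).2.1
    have hx1 : f 1 x = 0 := hs.elim (mul_eq_zero.1 hHx).resolve_left
      (mul_eq_zero.1 hpx).resolve_left
    refine ⟨hx0, hx1, ?_⟩
    rcases hBE with hB | ⟨hE, -⟩
    · exact (h.eq_zero_of_lie₁ hB fun y => (hx y).1).2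
    · rw [hx1, cc_zero, mul_zero, mul_zero, sub_zero] at hEx
      exact sub_conj_eq_zero.1 ((mul_eq_zero.1 hEx.symm).resolve_left hE)
  · rintro ⟨hx0, hx1, hx3⟩ y
    obtain ⟨h1, h2⟩ := h.lie_eq_zero hx0 hx1 hx3 y
    refine ⟨h1, h2, ?_⟩
    rw [h.im_lie₃, hx0]
    simp

lemma mem_ascending_two_iff_four (h : Coordinates J f A 0 Complex.I F 0 (1 / 2) 0 (1 / 2) L M N s)
    (hN : N ≠ 0) (hs : s ≠ 0) (x : g) :
    x ∈ ascending g 2 ↔ f 0 x = 0 ∧ (f 1 x).im = 0 ∧ (f 3 x).im = 0 := by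
  rw [h.mem_ascending_two_iff hN (Or.inr Complex.I_ne_zero) (Or.inr (Or.inr hs))]
  constructor
  · intro hx
    have hx0 := h.eq_zero_of_lie₂_left Complex.I_ne_zero rfl fun y => (hx y).2.1
    obtain ⟨-, -, hEx⟩ := h.eq_zero_of_lie₂ hx0 fun y => (hx y).2.1
    -- The relation is −i Im f₁ = −2 Im f₃. One side is imaginary and the other real, so both
    -- vanish; this is what E = i and κ = q = 1/2 achieve.
    have hre := congrArg Complex.re hEx
    have him := congrArg Complex.im hEx
    simp [Complex.mul_re, Complex.mul_im] at hre him
    exact ⟨hx0, by linarith, by linarith⟩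
  · rintro ⟨hx0, hx1, hx3⟩ y
    refine ⟨?_, ?_, ?_⟩
    · rw [h.lie₁, hx0, cc_zero]; ring
    · have h1 := sub_conj_eq_zero.2 hx1
      rw [h.lie₂, sub_conj_eq_zero.2 hx3, hx0, cc_zero]
      linear_combination (-(1 / 2) * f 0 y) * h1
    · rw [h.im_lie₃, hx0]
      simp

lemma mem_ascending_two_iff_five (h : Coordinates J f A 0 E F 0 0 0 0 L M N s)
    (hN : N ≠ 0) (hE : E ≠ 0) (hs : s ≠ 0) (x : g) :
    x ∈ ascending g 2 ↔ f 0 x = 0 ∧ (f 3 x).im = 0 := by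
  rw [h.mem_ascending_two_iff hN (Or.inr hE) (Or.inr (Or.inr hs))]
  constructor
  · intro hx
    have hx0 := h.eq_zero_of_lie₂_left hE rfl fun y => (hx y).2.1
    obtain ⟨-, -, hEx⟩ := h.eq_zero_of_lie₂ hx0 fun y => (hx y).2.1
    rw [zero_mul, zero_mul, sub_zero] at hEx
    exact ⟨hx0, sub_conj_eq_zero.1 ((mul_eq_zero.1 hEx.symm).resolve_left hE)⟩
  · rintro ⟨hx0, hx3⟩ y
    refine ⟨?_, ?_, ?_⟩
    · rw [h.lie₁, hx0, cc_zero]; ring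
    · rw [h.lie₂, sub_conj_eq_zero.2 hx3, hx0, cc_zero]
      ring
    · rw [h.im_lie₃, hx0]
      simp

lemma mem_ascending_three_iff_five (h : Coordinates J f A B E F H κ p q L M N s) (hN : N ≠ 0)
    (hB : B ≠ 0) (hs : H ≠ 0 ∨ p ≠ 0) (x : g) :
    x ∈ ascending g 3 ↔ f 0 x = 0 ∧ (f 3 x).im = 0 := by
  rw [mem_ascending_succ]
  simp only [h.mem_ascending_two_iff_three hN (Or.inl hB) hs, h.lie₀, true_and]
  constructor
  · exact fun hx => h.eq_zero_of_lie₁ hB fun y => (hx y).1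
  · rintro ⟨hx0, hx3⟩ y
    refine ⟨?_, ?_⟩
    · rw [h.lie₁, hx0, sub_conj_eq_zero.2 hx3, cc_zero]
      ring
    · rw [h.im_lie₃, hx0]
      simp

lemma eq_zero_of_im_conj_mul (h : Coordinates J f A B E F H κ p q L M N s) {r : ℝ} (hr : r ≠ 0)
    {x : g} (hx : ∀ y : g, 2 * r * (cc (f 0 x) * f 0 y).im = 0) : f 0 x = 0 := by
  refine NilComplex.eq_zero_of_im_conj_mul fun c => ?_
  obtain ⟨y, y0, -⟩ := h.surj c 0 0 0
  have := hx y
  rw [y0] at this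
  simpa [hr] using this

lemma ascending_succ_eq_top_of_mem_iff (h : Coordinates J f A B E F H κ p q L M N s) {k : ℕ}
    (hk : ∀ x, x ∈ ascending g k ↔ f 0 x = 0) : ascending g (k + 1) = ⊤ := by
  rw [eq_top_iff]
  intro x _
  rw [mem_ascending_succ]
  exact fun y => (hk _).2 (h.lie₀ x y)

lemma ascending_succ_eq_top_of_re (h : Coordinates J f A B E F H κ p q L M N s) {k : ℕ}
    (hk : ∀ x, x ∈ ascending g k ↔ f 0 x = 0 ∧ (f 3 x).im = 0) (hL : L.re = 0) :
    ascending g (k + 1) = ⊤ := by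
  rw [eq_top_iff]
  intro x _
  rw [mem_ascending_succ]
  refine fun y => (hk _).2 ⟨h.lie₀ x y, ?_⟩
  rw [h.im_lie₃, hL]
  simp

lemma mem_ascending_succ_of_re (h : Coordinates J f A B E F H κ p q L M N s) {k : ℕ}
    (hk : ∀ x, x ∈ ascending g k ↔ f 0 x = 0 ∧ (f 3 x).im = 0) (hL : L.re ≠ 0) (x : g) :
    x ∈ ascending g (k + 1) ↔ f 0 x = 0 := by
  rw [mem_ascending_succ]
  simp only [hk, h.lie₀, true_and, h.im_lie₃]
  refine ⟨h.eq_zero_of_im_conj_mul hL, fun hx y => ?_⟩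
  simp [hx]

/-- If `A` and `Re L` do not both vanish, then the third term is `{f₀ = 0}`. -/
lemma mem_ascending_three_iff_six (h : Coordinates J f A 0 E F H κ p q L M N s)
    (hk : ∀ x, x ∈ ascending g 2 ↔ f 0 x = 0 ∧ f 1 x = 0 ∧ (f 3 x).im = 0)
    (hAL : ¬ (A = 0 ∧ L.re = 0)) (x : g) : x ∈ ascending g 3 ↔ f 0 x = 0 := by
  rw [mem_ascending_succ]
  simp only [hk, h.lie₀, true_and, h.im_lie₃]
  constructor
  · intro hx
    by_cases hL : L.re = 0
    · have hA : A ≠ 0 := fun hA => hAL ⟨hA, hL⟩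
      refine NilComplex.eq_zero_of_im_conj_mul fun c => ?_
      obtain ⟨y, y0, -⟩ := h.surj c 0 0 0
      have h1 := (hx y).1
      rw [h.lie₁, y0, zero_mul, sub_zero] at h1
      have h2 := (mul_eq_zero.1 h1).resolve_left hA
      have h3 := im_mul_conj_sub 1 (f 0 x) c
      rw [h2] at h3
      simpa using h3
    · exact h.eq_zero_of_im_conj_mul hL fun y => (hx y).2
  · intro hx y
    rw [h.lie₁, hx]
    simp

/-- Only Im f₁ is constrained on g₂ here, and Im f₁[x,y] = 2 Re A · Im(conj(f₀x) f₀y); hence Re A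
takes the place of A. -/
lemma mem_ascending_three_iff_six' (h : Coordinates J f A 0 E F H κ p q L M N s)
    (hk : ∀ x, x ∈ ascending g 2 ↔ f 0 x = 0 ∧ (f 1 x).im = 0 ∧ (f 3 x).im = 0)
    (hAL : ¬ (A.re = 0 ∧ L.re = 0)) (x : g) : x ∈ ascending g 3 ↔ f 0 x = 0 := by
  rw [mem_ascending_succ]
  simp only [hk, h.lie₀, true_and, h.im_lie₃, h.lie₁, zero_mul, sub_zero, im_mul_conj_sub]
  constructor
  · intro hx
    by_cases hL : L.re = 0
    · exact h.eq_zero_of_im_conj_mul (fun hA => hAL ⟨hA, hL⟩) fun y => (hx y).1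
    · exact h.eq_zero_of_im_conj_mul hL fun y => (hx y).2
  · intro hx y
    simp [hx]

lemma ascending_three_eq_top (h : Coordinates J f A 0 E F H κ p q L M N s)
    (hk : ∀ x, x ∈ ascending g 2 ↔ f 0 x = 0 ∧ f 1 x = 0 ∧ (f 3 x).im = 0)
    (hA : A = 0) (hL : L.re = 0) : ascending g 3 = ⊤ := by
  rw [eq_top_iff]
  intro x _
  rw [mem_ascending_succ]
  intro y
  rw [hk, h.lie₀, h.im_lie₃, h.lie₁, hA, hL]
  simp

lemma ascending_three_eq_top' (h : Coordinates J f A 0 E F H κ p q L M N s)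
    (hk : ∀ x, x ∈ ascending g 2 ↔ f 0 x = 0 ∧ (f 1 x).im = 0 ∧ (f 3 x).im = 0)
    (hA : A.re = 0) (hL : L.re = 0) : ascending g 3 = ⊤ := by
  rw [eq_top_iff]
  intro x _
  rw [mem_ascending_succ]
  intro y
  rw [hk, h.lie₀, h.im_lie₃, h.lie₁, hL, zero_mul, sub_zero, im_mul_conj_sub, hA]
  simp

end Series

/-! ### The basis of (1,0)-forms and the structure equations -/

section Forms

lemma exists_basis_forms (h : Coordinates J f A B E F H κ p q L M N s) :
    ∃ ω : Basis (Fin 4) ℂ (formsOneZero J), ∀ i, (ω i : g →ₗ[ℝ] ℂ) = f i := by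
  obtain ⟨e₀, e00, e01, e02, e03⟩ := h.surj 1 0 0 0
  obtain ⟨e₁, e10, e11, e12, e13⟩ := h.surj 0 1 0 0
  obtain ⟨e₂, e20, e21, e22, e23⟩ := h.surj 0 0 1 0
  obtain ⟨e₃, e30, e31, e32, e33⟩ := h.surj 0 0 0 1
  let φ : Fin 4 → formsOneZero J := fun i => ⟨f i, h.map_J i⟩
  have hli : LinearIndependent ℂ φ := by
    rw [Fintype.linearIndependent_iff]
    intro c hc
    have key : ∀ x, c 0 * f 0 x + c 1 * f 1 x + c 2 * f 2 x + c 3 * f 3 x = 0 := fun x => by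
      have := congrArg (fun α : formsOneZero J => (α : g →ₗ[ℝ] ℂ) x) hc
      simpa [Fin.sum_univ_four, φ] using this
    have k0 := key e₀
    have k1 := key e₁
    have k2 := key e₂
    have k3 := key e₃
    rw [e00, e01, e02, e03] at k0
    rw [e10, e11, e12, e13] at k1
    rw [e20, e21, e22, e23] at k2
    rw [e30, e31, e32, e33] at k3
    simp only [mul_one, mul_zero, add_zero, zero_add] at k0 k1 k2 k3
    intro i
    fin_cases i
    exacts [k0, k1, k2, k3]
  have hsp : ⊤ ≤ Submodule.span ℂ (Set.range φ) := by
    intro α _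
    have hα : α = α.1 e₀ • φ 0 + α.1 e₁ • φ 1 + α.1 e₂ • φ 2 + α.1 e₃ • φ 3 := by
      refine Subtype.ext (LinearMap.ext fun x => ?_)
      -- This is f i x acting on e as a complex scalar through J; every (1,0)-form is complex linear
      -- for that action.
      let w : Fin 4 → g → g := fun i e => (f i x).re • e + (f i x).im • J e
      have hw : ∀ (β : g →ₗ[ℝ] ℂ), (∀ X, β (J X) = Complex.I * β X) → ∀ i e,
          β (w i e) = f i x * β e := fun β hβ i e => by
        simp only [w, map_add, map_smul, hβ, Complex.real_smul]
        linear_combination β e * Complex.re_add_im (f i x)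
      have hx : x - (w 0 e₀ + w 1 e₁ + w 2 e₂ + w 3 e₃) = 0 := by
        refine h.ext _ ?_ ?_ ?_ ?_ <;>
        simp only [map_sub, map_add, hw _ (h.map_J _), e00, e01, e02, e03, e10, e11, e12, e13, e20,
          e21, e22, e23, e30, e31, e32, e33] <;> ring
      have := congrArg α.1 hx
      simp only [map_sub, map_add, hw _ α.2, map_zero] at this
      simp only [φ, Submodule.coe_add, Submodule.coe_smul, LinearMap.add_apply,
        LinearMap.smul_apply, smul_eq_mul]
      linear_combination this
    have hm : ∀ i, φ i ∈ Submodule.span ℂ (Set.range φ) := fun i =>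
      Submodule.subset_span ⟨i, rfl⟩
    rw [hα]
    exact add_mem (add_mem (add_mem (Submodule.smul_mem _ _ (hm 0)) (Submodule.smul_mem _ _ (hm 1)))
      (Submodule.smul_mem _ _ (hm 2))) (Submodule.smul_mem _ _ (hm 3))
  exact ⟨Basis.mk hli hsp, fun i => by rw [Basis.mk_apply]⟩

lemma dOne_apply (α : g →ₗ[ℝ] ℂ) (x y : g) : dOne α x y = -α ⁅x, y⁆ := rfl

lemma wedge_apply (α β : g →ₗ[ℝ] ℂ) (x y : g) : wedge α β x y = α x * β y - α y * β x := rfl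

lemma conjForm_apply (α : g →ₗ[ℝ] ℂ) (x : g) : conjForm α x = cc (α x) := rfl

/-- The values of C, D and G are the unique solution of C − D = −κ, G + D = q, C − G = p. -/
lemma structureEquationsThree (h : Coordinates J f A B E F H κ p q L M N s) :
    StructureEquationsThree (f 0) (f 1) (f 2) (f 3) A B ((-κ + q + p) / 2) ((κ + q + p) / 2) E F
      ((-κ + q - p) / 2) H 0 L M N 0 s := by
  refine ⟨?_, ?_, ?_, ?_⟩ <;> refine LinearMap.ext₂ fun x y => ?_ <;>
  simp only [dOne_apply, wedge_apply, conjForm_apply, LinearMap.add_apply, LinearMap.sub_apply,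
    LinearMap.smul_apply, LinearMap.zero_apply, smul_eq_mul, h.lie₀, h.lie₁, h.lie₂, h.lie₃,
    map_zero] <;> ring

lemma structureEquationsFour (h : Coordinates J f A 0 E F 0 κ 0 κ L M N s) :
    StructureEquationsFour (f 0) (f 1) (f 2) (f 3) A κ E F L M N s := by
  refine ⟨?_, ?_, ?_, ?_⟩ <;> refine LinearMap.ext₂ fun x y => ?_ <;>
  simp only [dOne_apply, wedge_apply, conjForm_apply, LinearMap.add_apply, LinearMap.sub_apply,
    LinearMap.smul_apply, LinearMap.neg_apply, LinearMap.zero_apply, smul_eq_mul, h.lie₀, h.lie₁,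
    h.lie₂, h.lie₃] <;> ring

lemma structureEquationsFive (h : Coordinates J f A 0 E F 0 0 0 0 L M N s) :
    StructureEquationsFive (f 0) (f 1) (f 2) (f 3) A 0 E F L M N 0 s 0 := by
  refine ⟨?_, ?_, ?_, ?_⟩ <;> refine LinearMap.ext₂ fun x y => ?_ <;>
  simp only [dOne_apply, wedge_apply, conjForm_apply, LinearMap.add_apply, LinearMap.sub_apply,
    LinearMap.smul_apply, LinearMap.zero_apply, smul_eq_mul, h.lie₀, h.lie₁, h.lie₂, h.lie₃,
    map_zero, Complex.ofReal_zero] <;> ring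

end Forms

end Coordinates

end NilComplex

end

/-! ### Reading off the types -/

theorem mainTheorem12 {g : Type*} [LieRing g] [LieAlgebra ℝ g] [LieRing.IsNilpotent g]
    (hdim : Module.finrank ℝ g = 8) (J : g →ₗ[ℝ] g)
    (hJ : NilComplex.IsComplexStructure J) (hSnN : NilComplex.IsSnN J) :
    Module.finrank ℝ (NilComplex.ascending g 1) = 1 ∧
    ((Module.finrank ℝ (NilComplex.ascending g 2) = 3 ∧
        (NilComplex.HasAscendingType g [1, 3, 8] ∨ NilComplex.HasAscendingType g [1, 3, 6, 8] ∨
          NilComplex.HasAscendingType g [1, 3, 5, 8] ∨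
          NilComplex.HasAscendingType g [1, 3, 5, 6, 8]) ∧
        ∃ (ω : Module.Basis (Fin 4) ℂ (NilComplex.formsOneZero J))
          (A B C D E F G H K L M N P : ℂ) (s : ℝ),
          NilComplex.StructureEquationsThree (ω 0 : g →ₗ[ℝ] ℂ) (ω 1) (ω 2) (ω 3)
            A B C D E F G H K L M N P s ∧
          (NilComplex.HasAscendingType g [1, 3, 8] → A = 0 ∧ B = 0 ∧ L.re = 0) ∧
          (NilComplex.HasAscendingType g [1, 3, 6, 8] → B = 0 ∧ H = 0 ∧ K = 0 ∧ P = 0) ∧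
          (NilComplex.HasAscendingType g [1, 3, 5, 8] → K = 0 ∧ P = 0 ∧ L.re = 0) ∧
          (NilComplex.HasAscendingType g [1, 3, 5, 6, 8] →
            H = 0 ∧ K = 0 ∧ P = 0 ∧ s = 0 ∧ L.re ≠ 0)) ∨
     (Module.finrank ℝ (NilComplex.ascending g 2) = 4 ∧
        (NilComplex.HasAscendingType g [1, 4, 8] ∨ NilComplex.HasAscendingType g [1, 4, 6, 8]) ∧
        ∃ (ω : Module.Basis (Fin 4) ℂ (NilComplex.formsOneZero J))
          (A D E F L M N : ℂ) (s : ℝ),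
          NilComplex.StructureEquationsFour (ω 0 : g →ₗ[ℝ] ℂ) (ω 1) (ω 2) (ω 3)
            A D E F L M N s ∧
          (NilComplex.HasAscendingType g [1, 4, 8] → A.re = 0 ∧ L.re = 0) ∧
          (NilComplex.HasAscendingType g [1, 4, 6, 8] → ¬ (A.re = 0 ∧ L.re = 0))) ∨
     (Module.finrank ℝ (NilComplex.ascending g 2) = 5 ∧
        (NilComplex.HasAscendingType g [1, 5, 8] ∨ NilComplex.HasAscendingType g [1, 5, 6, 8]) ∧
        ∃ (ω : Module.Basis (Fin 4) ℂ (NilComplex.formsOneZero J))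
          (A B E F L M N P : ℂ) (s t : ℝ),
          NilComplex.StructureEquationsFive (ω 0 : g →ₗ[ℝ] ℂ) (ω 1) (ω 2) (ω 3)
            A B E F L M N P s t ∧
          (NilComplex.HasAscendingType g [1, 5, 8] → L.re = 0) ∧
          (NilComplex.HasAscendingType g [1, 5, 6, 8] → L.re ≠ 0))) := by
  obtain ⟨f, A, B, E, F, H, κ, p, q, L, M, N, s, h, hN, hcases⟩ :=
    NilComplex.exists_coordinates hdim hJ hSnN
  obtain ⟨ω, hω⟩ := h.exists_basis_forms
  have center := fun hBE hs => h.finrank_eq_one hdim (h.mem_ascending_one_iff hN hBE hs)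
  -- The two alternatives with B ≠ 0 are treated together: in both, dim g₂ = 3 and dim g₃ = 5.
  rcases or_assoc.2 hcases with hreg | ⟨rfl, hE, rfl, hp⟩ |
    ⟨rfl, rfl, rfl, rfl, rfl, rfl, hs⟩ | ⟨rfl, hE, rfl, rfl, rfl, rfl, hs⟩
  · obtain ⟨hB, hs⟩ : B ≠ 0 ∧ ((H ≠ 0 ∧ L.re = 0) ∨ (H = 0 ∧ p ≠ 0 ∧ s = 0)) := by
      tauto
    have hs' : H ≠ 0 ∨ p ≠ 0 := hs.imp And.left fun h => h.2.1
    have h1 := center (Or.inl hB) (hs'.imp_right Or.inl)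
    have h2 := h.finrank_eq_three hdim (h.mem_ascending_two_iff_three hN (Or.inl hB) hs')
    have h3 := h.mem_ascending_three_iff_five hN hB hs'
    refine ⟨h1, Or.inl ⟨h2, ?_⟩⟩
    by_cases hL : L.re = 0
    · have ht := NilComplex.hasAscendingType_four hdim h1 h2 (h.finrank_eq_five hdim h3)
        (h.ascending_succ_eq_top_of_re h3 hL) (by norm_num)
      refine ⟨Or.inr (Or.inr (Or.inl ht)), ω, A, B, _, _, E, F, _, H, 0, L, M, N, 0, s,
        by simpa only [hω] using h.structureEquationsThree,
        fun ht' => absurd (ht.unique ht') (by simp), fun ht' => absurd (ht.unique ht') (by simp),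
        fun _ => ⟨rfl, rfl, hL⟩, fun ht' => absurd (ht.unique ht') (by simp)⟩
    · have h4 := h.mem_ascending_succ_of_re h3 hL
      have ht := NilComplex.hasAscendingType_five hdim h1 h2 (h.finrank_eq_five hdim h3)
        (h.finrank_eq_six hdim h4) (h.ascending_succ_eq_top_of_mem_iff h4) (by norm_num)
      -- Re L ≠ 0 rules out the regular case, and the filiform case supplies H = s = 0.
      obtain ⟨hH, -, hs0⟩ := hs.resolve_left fun h => hL h.2
      exact ⟨Or.inr (Or.inr (Or.inr ht)), ω, A, B, _, _, E, F, _, H, 0, L, M, N, 0, s,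
        by simpa only [hω] using h.structureEquationsThree,
        fun ht' => absurd (ht.unique ht') (by simp), fun ht' => absurd (ht.unique ht') (by simp),
        fun ht' => absurd (ht.unique ht') (by simp), fun _ => ⟨hH, rfl, rfl, hs0, hL⟩⟩
  · have h1 := center (Or.inr hE) (Or.inr (Or.inl hp))
    have hk := h.mem_ascending_two_iff_three hN (Or.inr ⟨hE, rfl⟩) (Or.inr hp)
    have h2 := h.finrank_eq_three hdim hk
    refine ⟨h1, Or.inl ⟨h2, ?_⟩⟩
    by_cases hAL : A = 0 ∧ L.re = 0
    · have ht := NilComplex.hasAscendingType_three hdim h1 h2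
        (h.ascending_three_eq_top hk hAL.1 hAL.2) (by norm_num)
      exact ⟨Or.inl ht, ω, A, 0, _, _, E, F, _, 0, 0, L, M, N, 0, s,
        by simpa only [hω] using h.structureEquationsThree,
        fun _ => ⟨hAL.1, rfl, hAL.2⟩, fun ht' => absurd (ht.unique ht') (by simp),
        fun ht' => absurd (ht.unique ht') (by simp), fun ht' => absurd (ht.unique ht') (by simp)⟩
    · have h3 := h.mem_ascending_three_iff_six hk hAL
      have ht := NilComplex.hasAscendingType_four hdim h1 h2 (h.finrank_eq_six hdim h3)
        (h.ascending_succ_eq_top_of_mem_iff h3) (by norm_num)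
      exact ⟨Or.inr (Or.inl ht), ω, A, 0, _, _, E, F, _, 0, 0, L, M, N, 0, s,
        by simpa only [hω] using h.structureEquationsThree,
        fun ht' => absurd (ht.unique ht') (by simp), fun _ => ⟨rfl, rfl, rfl, rfl⟩,
        fun ht' => absurd (ht.unique ht') (by simp), fun ht' => absurd (ht.unique ht') (by simp)⟩
  · have h1 := center (Or.inr Complex.I_ne_zero) (Or.inr (Or.inr hs))
    have hk := h.mem_ascending_two_iff_four hN hs
    have h2 := h.finrank_eq_four hdim hk
    refine ⟨h1, Or.inr (Or.inl ⟨h2, ?_⟩)⟩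
    by_cases hAL : A.re = 0 ∧ L.re = 0
    · have ht := NilComplex.hasAscendingType_three hdim h1 h2
        (h.ascending_three_eq_top' hk hAL.1 hAL.2) (by norm_num)
      exact ⟨Or.inl ht, ω, A, _, _, F, L, M, N, s,
        by simpa only [hω] using h.structureEquationsFour,
        fun _ => hAL, fun ht' => absurd (ht.unique ht') (by simp)⟩
    · have h3 := h.mem_ascending_three_iff_six' hk hAL
      have ht := NilComplex.hasAscendingType_four hdim h1 h2 (h.finrank_eq_six hdim h3)
        (h.ascending_succ_eq_top_of_mem_iff h3) (by norm_num)
      exact ⟨Or.inr ht, ω, A, _, _, F, L, M, N, s,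
        by simpa only [hω] using h.structureEquationsFour,
        fun ht' => absurd (ht.unique ht') (by simp), fun _ => hAL⟩
  · have h1 := center (Or.inr hE) (Or.inr (Or.inr hs))
    have hk := h.mem_ascending_two_iff_five hN hE hs
    have h2 := h.finrank_eq_five hdim hk
    refine ⟨h1, Or.inr (Or.inr ⟨h2, ?_⟩)⟩
    by_cases hL : L.re = 0
    · have ht := NilComplex.hasAscendingType_three hdim h1 h2
        (h.ascending_succ_eq_top_of_re hk hL) (by norm_num)
      exact ⟨Or.inl ht, ω, A, _, E, F, L, M, N, _, s, _,
        by simpa only [hω] using h.structureEquationsFive,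
        fun _ => hL, fun ht' => absurd (ht.unique ht') (by simp)⟩
    · have h3 := h.mem_ascending_succ_of_re hk hL
      have ht := NilComplex.hasAscendingType_four hdim h1 h2 (h.finrank_eq_six hdim h3)
        (h.ascending_succ_eq_top_of_mem_iff h3) (by norm_num)
      exact ⟨Or.inr ht, ω, A, _, E, F, L, M, N, _, s, _,
        by simpa only [hω] using h.structureEquationsFive,
        fun ht' => absurd (ht.unique ht') (by simp), fun _ => hL⟩
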